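/- **Setting.** A *higher order signature* $\Sigma$ consists of a set $|\Sigma|$ of basic types, a distinguished $\mathsf{Prop}\in|\Sigma|$, and a set of function symbols $f:\sigma_1,\dots,\sigma_n\to\sigma_{n+1}$ for all basic types $\sigma_1,\dots,\sigma_{n+1}$. Types are generated from basic types and $1$ by $\sigma\times\tau$ and $\sigma\to\tau$. Terms in context, $\Gamma\vdash M:\tau$ (up to renaming of bound variables), are generated by variables, function symbols, $()$, pairs and projections, $\lambda$-abstraction and application, and, at type $\mathsf{Prop}$, by $M=_\sigma N$, $\top,\bot,\wedge,\vee,\Rightarrow$, $\forall_{x:\sigma},\exists_{x:\sigma}$ (all types $\sigma$), $\mathcal C(\varphi)$ and $\varphi\,\mathcal U\,\psi$; $\neg\varphi$ is $\varphi\Rightarrow\bot$. *Higher order SLCS* derives sequents $\Gamma\mid\Phi\vdash\psi$ ($\Phi$ a finite set of terms of type $\mathsf{Prop}$ in context $\Gamma$) by: the structural rules (axiom, weakening, cut, substitution of terms for variables); the usual intuitionistic rules for connectives and quantifiers; reflexivity and replacement for $=_\sigma$; the equations $(\lambda v.M)N=M[N/v]$, $\lambda v.M(v)=M$ ($v$ not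 free in $M$), $M=_1()$, $\pi_1(M,N)=M$, $\pi_2(M,N)=N$, $(\pi_1P,\pi_2P)=P$; the rule "from $\Gamma,v:\sigma\mid\ \vdash M=N$ infer $\Gamma\mid\ \vdash\lambda v.M=\lambda v.N$"; the rule "from $\Gamma\mid\varphi\vdash\psi$ and $\Gamma\mid\psi\vdash\varphi$ infer $\Gamma\mid\ \vdash\varphi=_{\mathsf{Prop}}\psi$"; and $$\frac{\Gamma\mid\Phi\vdash\psi}{\Gamma\mid\Phi\vdash\mathcal C(\psi)}\qquad\frac{\Gamma\mid\Phi,\psi\vdash\varphi}{\Gamma\mid\Phi,\mathcal C(\psi)\vdash\mathcal C(\varphi)}\qquad\frac{\Gamma\mid\Phi,\chi\vdash\varphi\quad\Gamma\mid\Phi,\mathcal C(\chi),\neg\chi\vdash\psi}{\Gamma\mid\Phi,\chi\vdash\varphi\,\mathcal U\,\psi}$$ $$\frac{\Gamma\mid\Phi,\ \chi\Rightarrow\varphi,\ (\mathcal C(\chi)\wedge\neg\chi)\Rightarrow\psi,\ \chi\vdash\theta\quad\text{for all }\chi\text{ with }\Gamma\vdash\chi:\mathsf{Prop}}{\Gamma\mid\Phi,\varphi\,\mathcal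 U\,\psi\vdash\theta}$$ The *classifying category* $\mathbf{Cl}(\Sigma)$ has the types as objects; its morphisms $\sigma\to\tau$ are the elements of $\mathrm{Term}(\sigma,\tau)$, the set of terms $x:\sigma\vdash M:\tau$ modulo provable equality ($M\sim N$ iff $x:\sigma\mid\ \vdash M=_\tau N$ is derivable); composition is substitution. An *elementary closure hyperdoctrine* $(\mathscr P,\mathfrak c)$ on a category $\mathbf C$ with finite products is a functor $\mathscr P:\mathbf C^{op}\to\mathbf{HA}$ to Heyting algebras such that: reindexing along each projection $D\times C\to C$ has a left adjoint $\exists$ and a right adjoint $\forall$, both satisfying the Beck–Chevalley condition, and $\exists$ satisfying Frobenius reciprocity; each object $C$ has a fibered equality $\delta_C\in\mathscr P(C\times C)$, i.e. for all $D$ the map $\mathscr P_{(\pi_1,\pi_2)}(-)\wedge\mathscr P_{(\pi_2,\pi_3)}(\delta_C)$ is left adjoint to $\mathscr P_{1_D\times\Delta_C}$; and $\mathfrak c$ is a family of monotone, inflationary maps $\mathfrak c_C:\mathscr P(C)\to\mathscr P(C)$ with $\mathfrak c_C\circ\mathscr P_f\le\mathscr P_f\circ\mathfrak c_D$ for all $f:C\to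 D$. A *morphism* $(\mathscr P,\mathfrak c)\to(\mathscr Q,\mathfrak d)$ is a finite product preserving functor $\mathscr F$ with a natural transformation $\eta:\mathscr P\to\mathscr Q\circ\mathscr F^{op}$ of Heyting algebra valued functors that preserves $\exists$, $\forall$ and $\delta$ (modulo $\mathscr F(C\times D)\cong\mathscr F(C)\times\mathscr F(D)$) and satisfies $\mathfrak d_{\mathscr F(C)}\circ\eta_C\le\eta_C\circ\mathfrak c_C$; it is *open* if equality holds. Let $\mathfrak c_\Sigma$ be $[\varphi]\mapsto[\mathcal C(\varphi)]$. A *model* of higher order SLCS in an elementary closure hyperdoctrine $(\mathscr P,\mathfrak c)$ on a cartesian closed category $\mathbf C$, with $\mathscr P$ isomorphic (as a set valued functor) to $\mathbf C(-,C)$ for an object $C$, is an open morphism $(\mathscr M,\mu):(\mathrm{Term}(-,\mathsf{Prop}),\mathfrak c_\Sigma)\to(\mathscr P,\mathfrak c)$ such that $\mathscr M(\mathsf{Prop})\cong C$ and $\mathscr M$ preserves exponentials. It *satisfies* $x:\sigma\mid\Phi\vdash\psi$ if $\bigwedge_{\varphi\in\Phi}\mu_\sigma([\varphi])\le\mu_\sigma([\psi])$;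 it satisfies a sequent in a context $x_1:\sigma_1,\dots,x_n:\sigma_n$ if it satisfies the sequent over the product of the types $\sigma_1,\dots,\sigma_n$ that is obtained by substituting the projections for the variables. **Theorem.** Let $\Sigma$ be a higher order signature. 1. $\mathbf{Cl}(\Sigma)$ is cartesian closed. 2. $(\mathrm{Term}(-,\mathsf{Prop}),\mathfrak c_\Sigma)$, with fibre over $\sigma$ ordered by derivability, is an elementary closure hyperdoctrine on $\mathbf{Cl}(\Sigma)$, whose fibered equality on $\sigma$ is $[\pi_1(x)=_\sigma\pi_2(x)]$; and for all $x:\sigma\vdash\varphi,\psi:\mathsf{Prop}$, $[\varphi]\le[\psi]$ iff $x:\sigma\mid\varphi\vdash\psi$ is derivable. 3. The identities $(1_{\mathbf{Cl}(\Sigma)},1_{\mathrm{Term}(-,\mathsf{Prop})})$ form a model (the *generic model*), and a sequent $\Gamma\mid\Phi\vdash\psi$ is satisfied by it if and only if it is derivable. 4. (Soundness and completeness) A derivable sequent is satisfied by every model, and a sequent satisfied by every model is derivable. -/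

import Mathlib

open CategoryTheory Opposite MonoidalCategory CartesianMonoidalCategory Limits

universe w u

namespace SLCS

/-! ### Higher order signatures, types and terms -/

/-- A higher order signature: a set of basic types, a distinguished basic type `Prop`, and for
every list of basic types `σ₁, …, σₙ` and basic type `σₙ₊₁` a set of function symbols
`σ₁, …, σₙ → σₙ₊₁`. -/
structure Signature where
  Base : Type u
  propBase : Base
  Fn : List Base → Base → Type u

/-- The types over a signature. -/
inductive Ty (S : Signature.{u}) : Type u
  | base : S.Base → Ty S
  | unit : Ty S
  | prod : Ty S → Ty S → Ty S
  | arr : Ty S → Ty S → Ty S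

/-- The type of propositions. -/
abbrev Ty.prop (S : Signature.{u}) : Ty S := .base S.propBase

variable {S : Signature.{u}}

/-- Contexts are lists of types; variables are de Bruijn indices, so that terms are taken up to
renaming of bound variables. -/
inductive Var : List (Ty S) → Ty S → Type u
  | z {Γ : List (Ty S)} {σ : Ty S} : Var (σ :: Γ) σ
  | s {Γ : List (Ty S)} {σ τ : Ty S} : Var Γ σ → Var (τ :: Γ) σ

/-- `Tm Γ τ` is the set of terms `M` with `Γ ⊢ M : τ`.  The binders `lam`, `all` and `ex` bind the
first variable of the extended context. -/
inductive Tm : List (Ty S) → Ty S → Type u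
  | var {Γ : List (Ty S)} {τ : Ty S} : Var Γ τ → Tm Γ τ
  | fn {Γ : List (Ty S)} {as : List S.Base} {b : S.Base} (f : S.Fn as b)
      (args : ∀ i : Fin as.length, Tm Γ (.base (as.get i))) : Tm Γ (.base b)
  | star {Γ : List (Ty S)} : Tm Γ .unit
  | pair {Γ : List (Ty S)} {σ τ : Ty S} : Tm Γ σ → Tm Γ τ → Tm Γ (.prod σ τ)
  | fst {Γ : List (Ty S)} {σ τ : Ty S} : Tm Γ (.prod σ τ) → Tm Γ σ
  | snd {Γ : List (Ty S)} {σ τ : Ty S} : Tm Γ (.prod σ τ) → Tm Γ τ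
  | lam {Γ : List (Ty S)} {σ τ : Ty S} : Tm (σ :: Γ) τ → Tm Γ (.arr σ τ)
  | app {Γ : List (Ty S)} {σ τ : Ty S} : Tm Γ (.arr σ τ) → Tm Γ σ → Tm Γ τ
  | eq {Γ : List (Ty S)} {σ : Ty S} : Tm Γ σ → Tm Γ σ → Tm Γ (.prop S)
  | top {Γ : List (Ty S)} : Tm Γ (.prop S)
  | bot {Γ : List (Ty S)} : Tm Γ (.prop S)
  | and {Γ : List (Ty S)} : Tm Γ (.prop S) → Tm Γ (.prop S) → Tm Γ (.prop S)
  | or {Γ : List (Ty S)} : Tm Γ (.prop S) → Tm Γ (.prop S) → Tm Γ (.prop S)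
  | imp {Γ : List (Ty S)} : Tm Γ (.prop S) → Tm Γ (.prop S) → Tm Γ (.prop S)
  | all {Γ : List (Ty S)} {σ : Ty S} : Tm (σ :: Γ) (.prop S) → Tm Γ (.prop S)
  | ex {Γ : List (Ty S)} {σ : Ty S} : Tm (σ :: Γ) (.prop S) → Tm Γ (.prop S)
  | cl {Γ : List (Ty S)} : Tm Γ (.prop S) → Tm Γ (.prop S)
  | unt {Γ : List (Ty S)} : Tm Γ (.prop S) → Tm Γ (.prop S) → Tm Γ (.prop S)

/-- Formulae in context: terms of type `Prop`. -/
abbrev Fm (Γ : List (Ty S)) : Type u := Tm Γ (.prop S)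

/-- Negation. -/
abbrev Tm.neg {Γ : List (Ty S)} (φ : Fm Γ) : Fm Γ := .imp φ .bot

/-! ### Renaming and simultaneous substitution -/

/-- Renamings of the variables of `Γ` by variables of `Δ`. -/
abbrev Ren (Δ Γ : List (Ty S)) : Type u := ∀ ⦃τ : Ty S⦄, Var Γ τ → Var Δ τ

/-- Simultaneous substitutions of terms in context `Δ` for the variables of `Γ`. -/
abbrev Sub (Δ Γ : List (Ty S)) : Type u := ∀ ⦃τ : Ty S⦄, Var Γ τ → Tm Δ τ

/-- Extension of a renaming under a binder. -/
def Ren.lift {Δ Γ : List (Ty S)} (r : Ren Δ Γ) (σ : Ty S) : Ren (σ :: Δ) (σ :: Γ)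
  | _, .z => .z
  | _, .s v => .s (r v)

/-- Renaming of a term. -/
def Tm.ren {Γ : List (Ty S)} {τ : Ty S} (M : Tm Γ τ) {Δ : List (Ty S)} (r : Ren Δ Γ) : Tm Δ τ :=
  match M with
  | .var v => .var (r v)
  | .fn f args => .fn f fun i => (args i).ren r
  | .star => .star
  | .pair M N => .pair (M.ren r) (N.ren r)
  | .fst M => .fst (M.ren r)
  | .snd M => .snd (M.ren r)
  | .lam M => .lam (M.ren (r.lift _))
  | .app M N => .app (M.ren r) (N.ren r)
  | .eq M N => .eq (M.ren r) (N.ren r)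
  | .top => .top
  | .bot => .bot
  | .and φ ψ => .and (φ.ren r) (ψ.ren r)
  | .or φ ψ => .or (φ.ren r) (ψ.ren r)
  | .imp φ ψ => .imp (φ.ren r) (ψ.ren r)
  | .all φ => .all (φ.ren (r.lift _))
  | .ex φ => .ex (φ.ren (r.lift _))
  | .cl φ => .cl (φ.ren r)
  | .unt φ ψ => .unt (φ.ren r) (ψ.ren r)

/-- Weakening of a term by one fresh variable. -/
abbrev Tm.wk {Γ : List (Ty S)} {τ : Ty S} (M : Tm Γ τ) (σ : Ty S) : Tm (σ :: Γ) τ :=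
  M.ren fun _ v => .s v

/-- Extension of a substitution under a binder. -/
def Sub.lift {Δ Γ : List (Ty S)} (s : Sub Δ Γ) (σ : Ty S) : Sub (σ :: Δ) (σ :: Γ)
  | _, .z => .var .z
  | _, .s v => (s v).wk σ

/-- Capture avoiding simultaneous substitution. -/
def Tm.subst {Γ : List (Ty S)} {τ : Ty S} (M : Tm Γ τ) {Δ : List (Ty S)} (s : Sub Δ Γ) : Tm Δ τ :=
  match M with
  | .var v => s v
  | .fn f args => .fn f fun i => (args i).subst s
  | .star => .star
  | .pair M N => .pair (M.subst s) (N.subst s)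
  | .fst M => .fst (M.subst s)
  | .snd M => .snd (M.subst s)
  | .lam M => .lam (M.subst (s.lift _))
  | .app M N => .app (M.subst s) (N.subst s)
  | .eq M N => .eq (M.subst s) (N.subst s)
  | .top => .top
  | .bot => .bot
  | .and φ ψ => .and (φ.subst s) (ψ.subst s)
  | .or φ ψ => .or (φ.subst s) (ψ.subst s)
  | .imp φ ψ => .imp (φ.subst s) (ψ.subst s)
  | .all φ => .all (φ.subst (s.lift _))
  | .ex φ => .ex (φ.subst (s.lift _))
  | .cl φ => .cl (φ.subst s)
  | .unt φ ψ => .unt (φ.subst s) (ψ.subst s)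

/-- The substitution on the empty context. -/
def Sub.nil {Δ : List (Ty S)} : Sub Δ ([] : List (Ty S)) := fun _ v => nomatch v

/-- The substitution `s, M`. -/
def Sub.cons {Δ Γ : List (Ty S)} {σ : Ty S} (s : Sub Δ Γ) (M : Tm Δ σ) : Sub Δ (σ :: Γ)
  | _, .z => M
  | _, .s v => s v

/-- The substitution `[M | x]` for the only variable of a one variable context `x : σ`. -/
abbrev Sub.one {Δ : List (Ty S)} {σ : Ty S} (M : Tm Δ σ) : Sub Δ [σ] := Sub.nil.cons M

/-- `M.inst N` is `M[N | x]` for the first variable `x` of the context. -/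
abbrev Tm.inst {Γ : List (Ty S)} {σ τ : Ty S} (M : Tm (σ :: Γ) τ) (N : Tm Γ σ) : Tm Γ τ :=
  M.subst (Sub.cons (fun _ v => .var v) N)

/-! ### Derivable sequents -/

/-- `Der Γ Φ φ`: the sequent `Γ ∣ Φ ⊢ φ` is derivable in higher order SLCS.  The finite set `Φ` is
given by a list, whose order and repetitions are irrelevant by the rule `weak`. -/
inductive Der : (Γ : List (Ty S)) → List (Fm Γ) → Fm Γ → Prop
  -- structural rules
  | ax {Γ : List (Ty S)} {Φ : List (Fm Γ)} {φ : Fm Γ} : φ ∈ Φ → Der Γ Φ φ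
  | weak {Γ : List (Ty S)} {Φ Ψ : List (Fm Γ)} {φ : Fm Γ} : Φ ⊆ Ψ → Der Γ Φ φ → Der Γ Ψ φ
  | cut {Γ : List (Ty S)} {Φ : List (Fm Γ)} {φ ψ : Fm Γ} :
      Der Γ Φ φ → Der Γ (φ :: Φ) ψ → Der Γ Φ ψ
  | subst {Γ Δ : List (Ty S)} {Φ : List (Fm Γ)} {φ : Fm Γ} (s : Sub Δ Γ) :
      Der Γ Φ φ → Der Δ (Φ.map fun χ => χ.subst s) (φ.subst s)
  -- intuitionistic connectives
  | top_intro {Γ : List (Ty S)} {Φ : List (Fm Γ)} : Der Γ Φ .top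
  | bot_elim {Γ : List (Ty S)} {Φ : List (Fm Γ)} {φ : Fm Γ} : Der Γ Φ .bot → Der Γ Φ φ
  | and_intro {Γ : List (Ty S)} {Φ : List (Fm Γ)} {φ ψ : Fm Γ} :
      Der Γ Φ φ → Der Γ Φ ψ → Der Γ Φ (.and φ ψ)
  | and_left {Γ : List (Ty S)} {Φ : List (Fm Γ)} {φ ψ : Fm Γ} : Der Γ Φ (.and φ ψ) → Der Γ Φ φ
  | and_right {Γ : List (Ty S)} {Φ : List (Fm Γ)} {φ ψ : Fm Γ} : Der Γ Φ (.and φ ψ) → Der Γ Φ ψ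
  | or_left {Γ : List (Ty S)} {Φ : List (Fm Γ)} {φ ψ : Fm Γ} : Der Γ Φ φ → Der Γ Φ (.or φ ψ)
  | or_right {Γ : List (Ty S)} {Φ : List (Fm Γ)} {φ ψ : Fm Γ} : Der Γ Φ ψ → Der Γ Φ (.or φ ψ)
  | or_elim {Γ : List (Ty S)} {Φ : List (Fm Γ)} {φ ψ θ : Fm Γ} :
      Der Γ Φ (.or φ ψ) → Der Γ (φ :: Φ) θ → Der Γ (ψ :: Φ) θ → Der Γ Φ θ
  | imp_intro {Γ : List (Ty S)} {Φ : List (Fm Γ)} {φ ψ : Fm Γ} :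
      Der Γ (φ :: Φ) ψ → Der Γ Φ (.imp φ ψ)
  | imp_elim {Γ : List (Ty S)} {Φ : List (Fm Γ)} {φ ψ : Fm Γ} :
      Der Γ Φ (.imp φ ψ) → Der Γ Φ φ → Der Γ Φ ψ
  -- quantifiers over all types
  | all_intro {Γ : List (Ty S)} {σ : Ty S} {Φ : List (Fm Γ)} {φ : Fm (σ :: Γ)} :
      Der (σ :: Γ) (Φ.map fun χ => χ.wk σ) φ → Der Γ Φ (.all φ)
  | all_elim {Γ : List (Ty S)} {σ : Ty S} {Φ : List (Fm Γ)} {φ : Fm (σ :: Γ)} (M : Tm Γ σ) :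
      Der Γ Φ (.all φ) → Der Γ Φ (φ.inst M)
  | ex_intro {Γ : List (Ty S)} {σ : Ty S} {Φ : List (Fm Γ)} {φ : Fm (σ :: Γ)} (M : Tm Γ σ) :
      Der Γ Φ (φ.inst M) → Der Γ Φ (.ex φ)
  | ex_elim {Γ : List (Ty S)} {σ : Ty S} {Φ : List (Fm Γ)} {φ : Fm (σ :: Γ)} {θ : Fm Γ} :
      Der Γ Φ (.ex φ) → Der (σ :: Γ) (φ :: Φ.map fun χ => χ.wk σ) (θ.wk σ) → Der Γ Φ θ
  -- equality: reflexivity and replacement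
  | eq_refl {Γ : List (Ty S)} {σ : Ty S} {Φ : List (Fm Γ)} (M : Tm Γ σ) : Der Γ Φ (.eq M M)
  | eq_subst {Γ : List (Ty S)} {σ : Ty S} {Φ : List (Fm Γ)} {M N : Tm Γ σ} (φ : Fm (σ :: Γ)) :
      Der Γ Φ (.eq M N) → Der Γ Φ (φ.inst M) → Der Γ Φ (φ.inst N)
  -- conversions of the typed lambda calculus
  | beta {Γ : List (Ty S)} {σ τ : Ty S} {Φ : List (Fm Γ)} (M : Tm (σ :: Γ) τ) (N : Tm Γ σ) :
      Der Γ Φ (.eq (.app (.lam M) N) (M.inst N))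
  | eta {Γ : List (Ty S)} {σ τ : Ty S} {Φ : List (Fm Γ)} (M : Tm Γ (.arr σ τ)) :
      Der Γ Φ (.eq (.lam (.app (M.wk σ) (.var .z))) M)
  | xi {Γ : List (Ty S)} {σ τ : Ty S} {M N : Tm (σ :: Γ) τ} :
      Der (σ :: Γ) [] (.eq M N) → Der Γ [] (.eq (.lam M) (.lam N))
  | unit_eta {Γ : List (Ty S)} {Φ : List (Fm Γ)} (M : Tm Γ .unit) : Der Γ Φ (.eq M .star)
  | fst_pair {Γ : List (Ty S)} {σ τ : Ty S} {Φ : List (Fm Γ)} (M : Tm Γ σ) (N : Tm Γ τ) :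
      Der Γ Φ (.eq (.fst (.pair M N)) M)
  | snd_pair {Γ : List (Ty S)} {σ τ : Ty S} {Φ : List (Fm Γ)} (M : Tm Γ σ) (N : Tm Γ τ) :
      Der Γ Φ (.eq (.snd (.pair M N)) N)
  | pair_eta {Γ : List (Ty S)} {σ τ : Ty S} {Φ : List (Fm Γ)} (M : Tm Γ (.prod σ τ)) :
      Der Γ Φ (.eq (.pair (.fst M) (.snd M)) M)
  -- provably equivalent propositions are provably equal
  | prop_ext {Γ : List (Ty S)} {φ ψ : Fm Γ} :
      Der Γ [φ] ψ → Der Γ [ψ] φ → Der Γ [] (.eq φ ψ)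
  -- the closure operator
  | cl_one {Γ : List (Ty S)} {Φ : List (Fm Γ)} {ψ : Fm Γ} : Der Γ Φ ψ → Der Γ Φ (.cl ψ)
  | cl_two {Γ : List (Ty S)} {Φ : List (Fm Γ)} {ψ φ : Fm Γ} :
      Der Γ (ψ :: Φ) φ → Der Γ (.cl ψ :: Φ) (.cl φ)
  -- the until (surroundedness) operator; its elimination rule has one premise for each `χ`
  | unt_intro {Γ : List (Ty S)} {Φ : List (Fm Γ)} {χ φ ψ : Fm Γ} :
      Der Γ (χ :: Φ) φ → Der Γ (.cl χ :: .neg χ :: Φ) ψ → Der Γ (χ :: Φ) (.unt φ ψ)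
  | unt_elim {Γ : List (Ty S)} {Φ : List (Fm Γ)} {φ ψ θ : Fm Γ} :
      (∀ χ : Fm Γ, Der Γ (χ :: .imp χ φ :: .imp (.and (.cl χ) (.neg χ)) ψ :: Φ) θ) →
        Der Γ (.unt φ ψ :: Φ) θ

/-! ### Substitution lemmas -/

theorem Tm.subst_var {Γ : List (Ty S)} {τ : Ty S} (M : Tm Γ τ) :
    M.subst (fun _ v => .var v) = M := by
  have hl : ∀ (Γ : List (Ty S)) (σ : Ty S),
      Sub.lift (fun _ v => .var v : Sub Γ Γ) σ = fun _ v => .var v := by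
    intro Γ σ; funext τ v; cases v <;> rfl
  induction M with
  | lam M ih | all M ih | ex M ih => simp only [Tm.subst, hl, ih]
  | fn f args ih => simp only [Tm.subst, ih]
  | pair M N ihM ihN | app M N ihM ihN | eq M N ihM ihN | and M N ihM ihN | or M N ihM ihN
  | imp M N ihM ihN | unt M N ihM ihN => simp only [Tm.subst, ihM, ihN]
  | fst M ih | snd M ih | cl M ih => simp only [Tm.subst, ih]
  | var v | star | top | bot => rfl

theorem Tm.subst_ren {Γ Δ E : List (Ty S)} {τ : Ty S} (M : Tm Γ τ) (r : Ren Δ Γ) (s : Sub E Δ) :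
    (M.ren r).subst s = M.subst (fun _ v => s (r v)) := by
  have hl : ∀ (Γ Δ E : List (Ty S)) (r : Ren Δ Γ) (s : Sub E Δ) (σ : Ty S),
      (fun τ (v : Var (σ :: Γ) τ) => s.lift σ (r.lift σ v)) = Sub.lift (fun _ v => s (r v)) σ := by
    intro Γ Δ E r s σ; funext τ v; cases v <;> rfl
  induction M generalizing Δ E with
  | lam M ih | all M ih | ex M ih => simp only [Tm.subst, Tm.ren, ih, hl]
  | fn f args ih => simp only [Tm.subst, Tm.ren, ih]
  | pair M N ihM ihN | app M N ihM ihN | eq M N ihM ihN | and M N ihM ihN | or M N ihM ihN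
  | imp M N ihM ihN | unt M N ihM ihN => simp only [Tm.subst, Tm.ren, ihM, ihN]
  | fst M ih | snd M ih | cl M ih => simp only [Tm.subst, Tm.ren, ih]
  | var v | star | top | bot => rfl

theorem Tm.ren_ren {Γ Δ E : List (Ty S)} {τ : Ty S} (M : Tm Γ τ) (r : Ren Δ Γ) (s : Ren E Δ) :
    (M.ren r).ren s = M.ren (fun _ v => s (r v)) := by
  have hl : ∀ (Γ Δ E : List (Ty S)) (r : Ren Δ Γ) (s : Ren E Δ) (σ : Ty S),
      (fun τ (v : Var (σ :: Γ) τ) => s.lift σ (r.lift σ v)) = Ren.lift (fun _ v => s (r v)) σ := by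
    intro Γ Δ E r s σ; funext τ v; cases v <;> rfl
  induction M generalizing Δ E with
  | lam M ih | all M ih | ex M ih => simp only [Tm.ren, ih, hl]
  | fn f args ih => simp only [Tm.ren, ih]
  | pair M N ihM ihN | app M N ihM ihN | eq M N ihM ihN | and M N ihM ihN | or M N ihM ihN
  | imp M N ihM ihN | unt M N ihM ihN => simp only [Tm.ren, ihM, ihN]
  | fst M ih | snd M ih | cl M ih => simp only [Tm.ren, ih]
  | var v | star | top | bot => rfl

theorem Tm.ren_subst {Γ Δ E : List (Ty S)} {τ : Ty S} (M : Tm Γ τ) (s : Sub Δ Γ) (r : Ren E Δ) :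
    (M.subst s).ren r = M.subst (fun _ v => (s v).ren r) := by
  have hl : ∀ (Γ Δ E : List (Ty S)) (s : Sub Δ Γ) (r : Ren E Δ) (σ : Ty S),
      (fun τ (v : Var (σ :: Γ) τ) => (s.lift σ v).ren (r.lift σ)) =
        Sub.lift (fun _ v => (s v).ren r) σ := by
    intro Γ Δ E s r σ; funext τ v
    cases v with
    | z => rfl
    | s v => simp only [Sub.lift, Tm.wk, Tm.ren_ren]; rfl
  induction M generalizing Δ E with
  | lam M ih | all M ih | ex M ih => simp only [Tm.subst, Tm.ren, ih, hl]
  | fn f args ih => simp only [Tm.subst, Tm.ren, ih]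
  | pair M N ihM ihN | app M N ihM ihN | eq M N ihM ihN | and M N ihM ihN | or M N ihM ihN
  | imp M N ihM ihN | unt M N ihM ihN => simp only [Tm.subst, Tm.ren, ihM, ihN]
  | fst M ih | snd M ih | cl M ih => simp only [Tm.subst, Tm.ren, ih]
  | var v | star | top | bot => rfl

theorem Tm.subst_subst {Γ Δ E : List (Ty S)} {τ : Ty S} (M : Tm Γ τ) (s : Sub Δ Γ) (t : Sub E Δ) :
    (M.subst s).subst t = M.subst (fun _ v => (s v).subst t) := by
  have hl : ∀ (Γ Δ E : List (Ty S)) (s : Sub Δ Γ) (t : Sub E Δ) (σ : Ty S),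
      (fun τ (v : Var (σ :: Γ) τ) => (s.lift σ v).subst (t.lift σ)) =
        Sub.lift (fun _ v => (s v).subst t) σ := by
    intro Γ Δ E s t σ; funext τ v
    cases v with
    | z => rfl
    | s v => simp only [Sub.lift, Tm.wk, Tm.subst_ren, Tm.ren_subst]
  induction M generalizing Δ E with
  | lam M ih | all M ih | ex M ih => simp only [Tm.subst, ih, hl]
  | fn f args ih => simp only [Tm.subst, ih]
  | pair M N ihM ihN | app M N ihM ihN | eq M N ihM ihN | and M N ihM ihN | or M N ihM ihN
  | imp M N ihM ihN | unt M N ihM ihN => simp only [Tm.subst, ihM, ihN]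
  | fst M ih | snd M ih | cl M ih => simp only [Tm.subst, ih]
  | var v | star | top | bot => rfl

theorem Tm.wk_inst {Γ : List (Ty S)} {σ τ : Ty S} (M : Tm Γ τ) (N : Tm Γ σ) :
    (M.wk σ).inst N = M := by
  rw [Tm.inst, Tm.wk, Tm.subst_ren]; exact M.subst_var

theorem Sub.cons_comp {Γ Δ E : List (Ty S)} {σ : Ty S} (s : Sub Δ Γ) (M : Tm Δ σ) (t : Sub E Δ) :
    (fun τ (v : Var (σ :: Γ) τ) => (s.cons M v).subst t) =
      Sub.cons (fun _ v => (s v).subst t) (M.subst t) := by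
  funext τ v; cases v <;> rfl

theorem Sub.one_comp {Δ E : List (Ty S)} {σ : Ty S} (M : Tm Δ σ) (t : Sub E Δ) :
    (fun τ (v : Var [σ] τ) => (Sub.one M v).subst t) = Sub.one (M.subst t) := by
  funext τ v
  cases v with
  | z => rfl
  | s v => cases v

theorem Sub.one_var (σ : Ty S) :
    Sub.one (.var .z : Tm [σ] σ) = fun _ v => .var v := by
  funext τ v
  cases v with
  | z => rfl
  | s v => cases v

theorem Der.eq_congr {Γ : List (Ty S)} {σ τ : Ty S} {Φ : List (Fm Γ)} {M N : Tm Γ σ}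
    (T : Tm (σ :: Γ) τ) (h : Der Γ Φ (.eq M N)) : Der Γ Φ (.eq (T.inst M) (T.inst N)) := by
  have h' := Der.eq_subst (.eq ((T.inst M).wk σ) T) h
  have e : ∀ N : Tm Γ σ, Tm.inst (.eq ((T.inst M).wk σ) T) N = .eq (T.inst M) (T.inst N) := by
    intro N
    change Tm.eq (((T.inst M).wk σ).inst N) (T.inst N) = _
    rw [Tm.wk_inst]
  rw [e, e] at h'
  exact h' (.eq_refl _)

theorem Der.eq_symm {Γ : List (Ty S)} {σ : Ty S} {Φ : List (Fm Γ)} {M N : Tm Γ σ}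
    (h : Der Γ Φ (.eq M N)) : Der Γ Φ (.eq N M) := by
  have h' := Der.eq_subst (.eq (.var .z) (M.wk σ)) h
  have e : ∀ N : Tm Γ σ, Tm.inst (.eq (.var .z) (M.wk σ)) N = .eq N M := by
    intro N
    change Tm.eq N ((M.wk σ).inst N) = _
    rw [Tm.wk_inst]
  rw [e, e] at h'
  exact h' (.eq_refl _)

theorem Der.eq_trans {Γ : List (Ty S)} {σ : Ty S} {Φ : List (Fm Γ)} {M N P : Tm Γ σ}
    (h : Der Γ Φ (.eq M N)) (h₂ : Der Γ Φ (.eq N P)) : Der Γ Φ (.eq M P) := by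
  have h' := Der.eq_subst (.eq (M.wk σ) (.var .z)) h₂
  have e : ∀ N : Tm Γ σ, Tm.inst (.eq (M.wk σ) (.var .z)) N = .eq M N := by
    intro N
    change Tm.eq ((M.wk σ).inst N) N = _
    rw [Tm.wk_inst]
  rw [e, e] at h'
  exact h' h

theorem Der.eq_mp {Γ : List (Ty S)} {Φ : List (Fm Γ)} {φ ψ : Fm Γ}
    (h : Der Γ Φ (.eq φ ψ)) (h₂ : Der Γ Φ φ) : Der Γ Φ ψ :=
  Der.eq_subst (.var .z) h h₂

theorem Der.nil {Γ : List (Ty S)} {Φ : List (Fm Γ)} {φ : Fm Γ} (h : Der Γ [] φ) : Der Γ Φ φ :=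
  .weak (by simp) h

/-- A sequent with one hypothesis may be applied to a derivation of that hypothesis. -/
theorem Der.mp {Γ : List (Ty S)} {Φ : List (Fm Γ)} {φ ψ : Fm Γ} (h : Der Γ [φ] ψ)
    (h₂ : Der Γ Φ φ) : Der Γ Φ ψ :=
  .cut h₂ (.weak (by simp) h)

/-! ### The classifying category -/

/-- Provable equality of terms `x : σ ⊢ M, N : τ`. -/
instance termSetoid (σ τ : Ty S) : Setoid (Tm [σ] τ) where
  r M N := Der [σ] [] (.eq M N)
  iseqv := ⟨fun M => .eq_refl M, fun h => h.eq_symm, fun h h' => h.eq_trans h'⟩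

/-- The set of terms from `σ` to `τ` modulo provable equality. -/
def Term (σ τ : Ty S) : Type u := Quotient (termSetoid σ τ)

/-- The class of a term. -/
def Term.mk {σ τ : Ty S} (M : Tm [σ] τ) : Term σ τ := Quotient.mk _ M

theorem Der.congr_one {Γ : List (Ty S)} {σ τ : Ty S} {Φ : List (Fm Γ)} {M N : Tm Γ σ}
    (T : Tm [σ] τ) (h : Der Γ Φ (.eq M N)) :
    Der Γ Φ (.eq (T.subst (.one M)) (T.subst (.one N))) := by
  have h' := h.eq_congr (T.subst (.one (.var .z)))
  rw [Tm.inst, Tm.inst, Tm.subst_subst, Tm.subst_subst, Sub.one_comp, Sub.one_comp] at h'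
  exact h'

/-- Composition is substitution. -/
def Term.comp {σ τ ρ : Ty S} : Term σ τ → Term τ ρ → Term σ ρ :=
  Quotient.map₂ (fun M N => N.subst (.one M)) fun M _ hM _ N' hN =>
    Der.eq_trans (Der.subst (.one M) hN) (Der.congr_one N' hM)

/-- The classifying category: objects are types, morphisms are terms modulo provable equality. -/
instance : Category.{u} (Ty S) where
  Hom σ τ := Term σ τ
  id _ := Term.mk (.var .z)
  comp := Term.comp
  id_comp f := by
    induction f using Quotient.inductionOn with
    | h M => exact congrArg Term.mk (by beta_reduce; rw [Sub.one_var, Tm.subst_var])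
  comp_id f := by
    induction f using Quotient.inductionOn with
    | h M => rfl
  assoc f g h := by
    induction f using Quotient.inductionOn with
    | h M =>
      induction g using Quotient.inductionOn with
      | h N =>
        induction h using Quotient.inductionOn with
        | h P => exact congrArg Term.mk (by beta_reduce; rw [Tm.subst_subst, Sub.one_comp])

/-- The morphism represented by a term. -/
abbrev hom {σ τ : Ty S} (M : Tm [σ] τ) : σ ⟶ τ := Term.mk M

/-- The type `1` is terminal. -/
def unitIsTerminal : IsTerminal (Ty.unit : Ty S) :=
  IsTerminal.ofUniqueHom (fun _ => hom .star) fun σ f => by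
    induction f using Quotient.inductionOn with
    | h M => exact Quotient.sound (Der.unit_eta M)

/-- The pairing of two classes of terms. -/
def Term.pair {ρ σ τ : Ty S} : Term ρ σ → Term ρ τ → Term ρ (.prod σ τ) :=
  Quotient.map₂ .pair fun M M' hM N N' hN => by
    have h₁ := hM.eq_congr (.pair (.var .z) (N.wk σ))
    have h₂ := hN.eq_congr (.pair (M'.wk τ) (.var .z))
    have e₁ : ∀ P, Tm.inst (.pair (.var .z) (N.wk σ)) P = .pair P N := fun P => by
      change Tm.pair P ((N.wk σ).inst P) = _
      rw [Tm.wk_inst]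
    have e₂ : ∀ P, Tm.inst (.pair (M'.wk τ) (.var .z)) P = .pair M' P := fun P => by
      change Tm.pair ((M'.wk τ).inst P) P = _
      rw [Tm.wk_inst]
    rw [e₁, e₁] at h₁
    rw [e₂, e₂] at h₂
    exact h₁.eq_trans h₂

theorem Term.pair_fst {ρ σ τ : Ty S} (f : ρ ⟶ σ) (g : ρ ⟶ τ) :
    (Term.pair f g : ρ ⟶ .prod σ τ) ≫ hom (.fst (.var .z)) = f := by
  induction f using Quotient.inductionOn with
  | h M =>
    induction g using Quotient.inductionOn with
    | h N => exact Quotient.sound (Der.fst_pair M N)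

theorem Term.pair_snd {ρ σ τ : Ty S} (f : ρ ⟶ σ) (g : ρ ⟶ τ) :
    (Term.pair f g : ρ ⟶ .prod σ τ) ≫ hom (.snd (.var .z)) = g := by
  induction f using Quotient.inductionOn with
  | h M =>
    induction g using Quotient.inductionOn with
    | h N => exact Quotient.sound (Der.snd_pair M N)

theorem Term.pair_eta {ρ σ τ : Ty S} (f : ρ ⟶ .prod σ τ) :
    (Term.pair (f ≫ hom (.fst (.var .z))) (f ≫ hom (.snd (.var .z))) : ρ ⟶ .prod σ τ) = f := by
  induction f using Quotient.inductionOn with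
  | h M => exact Quotient.sound (Der.pair_eta M)

/-- The type `σ × τ` with its two projections is a product of `σ` and `τ`. -/
def prodIsLimit (σ τ : Ty S) :
    IsLimit (BinaryFan.mk (P := Ty.prod σ τ) (hom (.fst (.var .z))) (hom (.snd (.var .z)))) :=
  BinaryFan.isLimitMk (fun s => Term.pair s.fst s.snd) (fun s => Term.pair_fst _ _)
    (fun s => Term.pair_snd _ _) fun s m h₁ h₂ => by
      rw [← h₁, ← h₂]; exact (Term.pair_eta m).symm

/-- Finite products in the classifying category are given by the types `1` and `σ × τ`. -/
instance : CartesianMonoidalCategory (Ty S) :=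
  .ofChosenFiniteProducts ⟨_, unitIsTerminal⟩ fun σ τ => ⟨_, prodIsLimit σ τ⟩

/-! ### The doctrine of terms of type `Prop` -/

/-- The order `[φ] ≤ [ψ]` of predicates is derivability of `x : σ ∣ φ ⊢ ψ`. -/
def Term.le {σ : Ty S} : Term σ (.prop S) → Term σ (.prop S) → Prop :=
  Quotient.lift₂ (fun φ ψ => Der [σ] [φ] ψ) fun φ ψ φ' ψ' hφ hψ => propext
    ⟨fun h => (hψ.nil).eq_mp (h.mp ((Der.nil hφ.eq_symm).eq_mp (.ax (by simp)))),
      fun h => (Der.nil hψ.eq_symm).eq_mp (h.mp ((hφ.nil).eq_mp (.ax (by simp))))⟩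

instance (σ : Ty S) : PartialOrder (Term σ (.prop S)) where
  le := Term.le
  le_refl a := by
    induction a using Quotient.inductionOn with
    | h φ => exact Der.ax (by simp)
  le_trans a b c := by
    induction a using Quotient.inductionOn with
    | h φ =>
      induction b using Quotient.inductionOn with
      | h ψ =>
        induction c using Quotient.inductionOn with
        | h χ => exact fun h₁ h₂ => Der.mp h₂ h₁
  le_antisymm a b := by
    induction a using Quotient.inductionOn with
    | h φ =>
      induction b using Quotient.inductionOn with
      | h ψ => exact fun h₁ h₂ => Quotient.sound (Der.prop_ext h₁ h₂)

theorem Der.eq_iff {Γ : List (Ty S)} {φ ψ : Fm Γ} :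
    Der Γ [] (.eq φ ψ) ↔ Der Γ [φ] ψ ∧ Der Γ [ψ] φ :=
  ⟨fun h => ⟨h.nil.eq_mp (.ax (by simp)), (Der.nil h.eq_symm).eq_mp (.ax (by simp))⟩,
    fun h => .prop_ext h.1 h.2⟩

/-- A connective on predicates. -/
def Term.and {σ : Ty S} : Term σ (.prop S) → Term σ (.prop S) → Term σ (.prop S) :=
  Quotient.map₂ .and fun φ φ' h ψ ψ' h' => by
    have h := Der.eq_iff.1 h
    have h' := Der.eq_iff.1 h'
    exact .prop_ext
      (.and_intro (h.1.mp (.and_left (ψ := ψ) (.ax (by simp))))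
        (h'.1.mp (.and_right (φ := φ) (.ax (by simp)))))
      (.and_intro (h.2.mp (.and_left (ψ := ψ') (.ax (by simp))))
        (h'.2.mp (.and_right (φ := φ') (.ax (by simp)))))

/-- A connective on predicates. -/
def Term.or {σ : Ty S} : Term σ (.prop S) → Term σ (.prop S) → Term σ (.prop S) :=
  Quotient.map₂ .or fun _ _ h _ _ h' => by
    have h := Der.eq_iff.1 h
    have h' := Der.eq_iff.1 h'
    exact .prop_ext
      (.or_elim (.ax (List.mem_singleton_self _)) (.or_left (h.1.mp (.ax (by simp))))
        (.or_right (h'.1.mp (.ax (by simp)))))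
      (.or_elim (.ax (List.mem_singleton_self _)) (.or_left (h.2.mp (.ax (by simp))))
        (.or_right (h'.2.mp (.ax (by simp)))))

/-- A connective on predicates. -/
def Term.imp {σ : Ty S} : Term σ (.prop S) → Term σ (.prop S) → Term σ (.prop S) :=
  Quotient.map₂ .imp fun φ φ' h ψ ψ' h' => by
    have h := Der.eq_iff.1 h
    have h' := Der.eq_iff.1 h'
    exact .prop_ext
      (.imp_intro (h'.1.mp (.imp_elim (φ := φ) (.ax (by simp)) (h.2.mp (.ax (by simp))))))
      (.imp_intro (h'.2.mp (.imp_elim (φ := φ') (.ax (by simp)) (h.1.mp (.ax (by simp))))))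

/-- The predicates over a type form a Heyting algebra. -/
instance (σ : Ty S) : HeytingAlgebra (Term σ (.prop S)) where
  inf := Term.and
  sup := Term.or
  himp := Term.imp
  top := Term.mk .top
  bot := Term.mk .bot
  compl a := Term.imp a (Term.mk .bot)
  himp_bot _ := rfl
  le_top a := by
    induction a using Quotient.inductionOn with
    | h φ => exact Der.top_intro
  bot_le a := by
    induction a using Quotient.inductionOn with
    | h φ => exact Der.bot_elim (.ax (by simp))
  inf_le_left a b := by
    induction a, b using Quotient.inductionOn₂ with
    | h φ ψ => exact Der.and_left (ψ := ψ) (.ax (by simp))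
  inf_le_right a b := by
    induction a, b using Quotient.inductionOn₂ with
    | h φ ψ => exact Der.and_right (φ := φ) (.ax (by simp))
  le_inf a b c := by
    induction a, b, c using Quotient.inductionOn₃ with
    | h φ ψ χ => exact fun h₁ h₂ => Der.and_intro h₁ h₂
  le_sup_left a b := by
    induction a, b using Quotient.inductionOn₂ with
    | h φ ψ => exact Der.or_left (.ax (by simp))
  le_sup_right a b := by
    induction a, b using Quotient.inductionOn₂ with
    | h φ ψ => exact Der.or_right (.ax (by simp))
  sup_le a b c := by
    induction a, b, c using Quotient.inductionOn₃ with
    | h φ ψ χ =>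
      exact fun h₁ h₂ => Der.or_elim (.ax (List.mem_singleton_self _))
        (Der.mp h₁ (.ax (by simp))) (Der.mp h₂ (.ax (by simp)))
  le_himp_iff a b c := by
    induction a, b, c using Quotient.inductionOn₃ with
    | h φ ψ χ =>
      exact ⟨fun h => Der.imp_elim (Der.mp h (.and_left (ψ := ψ) (.ax (by simp))))
          (.and_right (φ := φ) (.ax (by simp))),
        fun h => Der.imp_intro (Der.mp h (.and_intro (.ax (by simp)) (.ax (by simp))))⟩

/-- Substitution along a morphism is a morphism of Heyting algebras. -/
def Term.reindex {σ τ : Ty S} (f : σ ⟶ τ) : HeytingHom (Term τ (.prop S)) (Term σ (.prop S)) where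
  toFun a := Term.comp f a
  map_sup' a b := by
    induction f using Quotient.inductionOn with
    | h M =>
      induction a, b using Quotient.inductionOn₂ with
      | h φ ψ => rfl
  map_inf' a b := by
    induction f using Quotient.inductionOn with
    | h M =>
      induction a, b using Quotient.inductionOn₂ with
      | h φ ψ => rfl
  map_bot' := by
    induction f using Quotient.inductionOn with
    | h M => rfl
  map_himp' a b := by
    induction f using Quotient.inductionOn with
    | h M =>
      induction a, b using Quotient.inductionOn₂ with
      | h φ ψ => rfl

/-- The functor `Term(-, Prop)` from the opposite of the classifying category to Heyting algebras;
on underlying sets it is the representable functor of `Prop`. -/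
def termDoctrine (S : Signature.{u}) : (Ty S)ᵒᵖ ⥤ HeytAlg.{u} where
  obj σ := HeytAlg.of (Term σ.unop (.prop S))
  map f := HeytAlg.ofHom (Term.reindex f.unop)
  map_id σ := by
    ext a
    exact Category.id_comp (X := σ.unop) (Y := Ty.prop S) a
  map_comp {σ τ ρ} f g := by
    ext a
    exact Category.assoc (W := ρ.unop) (X := τ.unop) (Y := σ.unop) (Z := Ty.prop S)
      g.unop f.unop a

/-- The class `[φ]` of a formula `x : σ ⊢ φ : Prop` in the fibre over `σ`. -/
def pred {σ : Ty S} (φ : Fm [σ]) : (termDoctrine S).obj (op σ) := Term.mk φ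

/-- The closure operator `[φ] ↦ [C(φ)]`. -/
def termClosure (S : Signature.{u}) (σ : Ty S) :
    (termDoctrine S).obj (op σ) → (termDoctrine S).obj (op σ) :=
  Quotient.map (sa := termSetoid σ (.prop S)) (sb := termSetoid σ (.prop S)) .cl
    fun _ _ h => .prop_ext (.cl_two (Der.eq_iff.1 h).1) (.cl_two (Der.eq_iff.1 h).2)

/-! ### Closure hyperdoctrines -/

section Doctrines

variable {C : Type w} [Category.{u} C] [CartesianMonoidalCategory C]

/-- A functor to Heyting algebras, on a category with finite products, is a hyperdoctrine if
reindexing along each projection `D × X ⟶ X` has a left and a right adjoint, both satisfying the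
Beck-Chevalley condition, the left one also satisfying Frobenius reciprocity. -/
structure IsHyperdoctrine (P : Cᵒᵖ ⥤ HeytAlg.{u}) : Prop where
  exists_ex : ∃ ex : ∀ D X : C, P.obj (op (D ⊗ X)) → P.obj (op X),
    (∀ D X, GaloisConnection (ex D X) (P.map (snd D X).op)) ∧
    (∀ (D : C) {X X' : C} (f : X' ⟶ X) (β : P.obj (op (D ⊗ X))),
      ex D X' (P.map (D ◁ f).op β) = P.map f.op (ex D X β)) ∧
    (∀ (D X : C) (α : P.obj (op X)) (β : P.obj (op (D ⊗ X))),
      ex D X (P.map (snd D X).op α ⊓ β) = α ⊓ ex D X β)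
  exists_all : ∃ all : ∀ D X : C, P.obj (op (D ⊗ X)) → P.obj (op X),
    (∀ D X, GaloisConnection (P.map (snd D X).op) (all D X)) ∧
    (∀ (D : C) {X X' : C} (f : X' ⟶ X) (β : P.obj (op (D ⊗ X))),
      all D X' (P.map (D ◁ f).op β) = P.map f.op (all D X β))

/-- `δ` is a fibered equality on `X`: for each `D`, the map
`α ↦ P_(π₁,π₂)(α) ∧ P_(π₂,π₃)(δ)` is left adjoint to reindexing along `1_D × Δ_X`. -/
def IsFiberedEquality (P : Cᵒᵖ ⥤ HeytAlg.{u}) (X : C) (δ : P.obj (op (X ⊗ X))) : Prop :=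
  ∀ D : C, GaloisConnection
    (fun α : P.obj (op (D ⊗ X)) => P.map (D ◁ fst X X).op α ⊓ P.map (snd D (X ⊗ X)).op δ)
    (P.map (D ◁ lift (𝟙 X) (𝟙 X)).op)

/-- Closure operators on a doctrine. -/
structure IsClosureOperator (P : Cᵒᵖ ⥤ HeytAlg.{u})
    (c : ∀ X : C, P.obj (op X) → P.obj (op X)) : Prop where
  monotone : ∀ X, Monotone (c X)
  inflationary : ∀ X α, α ≤ c X α
  continuous : ∀ {X Y : C} (f : X ⟶ Y) (α : P.obj (op Y)),
    c X (P.map f.op α) ≤ P.map f.op (c Y α)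

/-- Elementary closure hyperdoctrines. -/
structure IsElementaryClosureHyperdoctrine (P : Cᵒᵖ ⥤ HeytAlg.{u})
    (c : ∀ X : C, P.obj (op X) → P.obj (op X)) : Prop where
  hyperdoctrine : IsHyperdoctrine P
  elementary : ∀ X, ∃ δ, IsFiberedEquality P X δ
  closure : IsClosureOperator P c

variable {D : Type*} [Category.{u} D] [CartesianMonoidalCategory D]

/-- `(F, η)` is a morphism of elementary closure hyperdoctrines.  The components of the natural
transformation `η` are morphisms of Heyting algebras.  In `map_ex` and `map_all`, `b` is the element
that corresponds to `η(a)` under the isomorphism `F(Y × X) ≅ F(Y) × F(X)`. -/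
structure IsMorphism (P : Cᵒᵖ ⥤ HeytAlg.{u}) (c : ∀ X : C, P.obj (op X) → P.obj (op X))
    (Q : Dᵒᵖ ⥤ HeytAlg.{u}) (d : ∀ X : D, Q.obj (op X) → Q.obj (op X))
    (F : C ⥤ D) (η : P ⟶ F.op ⋙ Q) : Prop where
  [preservesFiniteProducts : PreservesFiniteProducts F]
  map_ex : ∀ (Y X : C) (ex : P.obj (op (Y ⊗ X)) → P.obj (op X))
    (ex' : Q.obj (op (F.obj Y ⊗ F.obj X)) → Q.obj (op (F.obj X))),
    GaloisConnection ex (P.map (snd Y X).op) →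
    GaloisConnection ex' (Q.map (snd (F.obj Y) (F.obj X)).op) →
    ∀ (a : P.obj (op (Y ⊗ X))) (b : Q.obj (op (F.obj Y ⊗ F.obj X))),
      Q.map (CartesianMonoidalCategory.prodComparison F Y X).op b = η.app (op (Y ⊗ X)) a →
      η.app (op X) (ex a) = ex' b
  map_all : ∀ (Y X : C) (all : P.obj (op (Y ⊗ X)) → P.obj (op X))
    (all' : Q.obj (op (F.obj Y ⊗ F.obj X)) → Q.obj (op (F.obj X))),
    GaloisConnection (P.map (snd Y X).op) all →
    GaloisConnection (Q.map (snd (F.obj Y) (F.obj X)).op) all' →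
    ∀ (a : P.obj (op (Y ⊗ X))) (b : Q.obj (op (F.obj Y ⊗ F.obj X))),
      Q.map (CartesianMonoidalCategory.prodComparison F Y X).op b = η.app (op (Y ⊗ X)) a →
      η.app (op X) (all a) = all' b
  map_eq : ∀ (X : C) (δ : P.obj (op (X ⊗ X))) (δ' : Q.obj (op (F.obj X ⊗ F.obj X))),
    IsFiberedEquality P X δ → IsFiberedEquality Q (F.obj X) δ' →
    η.app (op (X ⊗ X)) δ = Q.map (CartesianMonoidalCategory.prodComparison F X X).op δ'
  continuous : ∀ (X : C) (α : P.obj (op X)),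
    d (F.obj X) (η.app (op X) α) ≤ η.app (op X) (c X α)

end Doctrines

/-! ### Models and satisfaction -/

section Models

variable {D : Type w} [Category.{u} D] [CartesianMonoidalCategory D]

/-- `(M, μ)` is a model of higher order SLCS in the elementary closure hyperdoctrine `(Q, d)`,
where `Q` is isomorphic to a representable functor on a cartesian closed category. -/
structure IsModel [MonoidalClosed (Ty S)] [MonoidalClosed D]
    (Q : Dᵒᵖ ⥤ HeytAlg.{u}) (d : ∀ X : D, Q.obj (op X) → Q.obj (op X))
    (M : Ty S ⥤ D) (μ : termDoctrine S ⟶ M.op ⋙ Q) : Prop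
    extends IsMorphism (termDoctrine S) (termClosure S) Q d M μ where
  target : IsElementaryClosureHyperdoctrine Q d
  representable : ∃ Ω : D, Nonempty ((Q ⋙ forget HeytAlg).RepresentableBy Ω) ∧
    Nonempty (M.obj (Ty.prop S) ≅ Ω)
  preservesExponentials : MonoidalClosedFunctor M
  isOpen : ∀ (σ : Ty S) (α : (termDoctrine S).obj (op σ)),
    d (M.obj σ) (μ.app (op σ) α) = μ.app (op σ) (termClosure S σ α)

/-- The sequent `x : σ ∣ Φ ⊢ ψ` is satisfied by `(M, μ)`. -/
def Satisfies (Q : Dᵒᵖ ⥤ HeytAlg.{u}) (M : Ty S ⥤ D) (μ : termDoctrine S ⟶ M.op ⋙ Q)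
    (σ : Ty S) (Φ : List (Fm [σ])) (ψ : Fm [σ]) : Prop :=
  (Φ.map fun φ => μ.app (op σ) (pred φ)).foldr (· ⊓ ·) ⊤ ≤ μ.app (op σ) (pred ψ)

/-- The product of the types of a context. -/
def ctxTy : List (Ty S) → Ty S
  | [] => .unit
  | σ :: Γ => .prod (ctxTy Γ) σ

/-- The substitution of the projections of `x : ctxTy Γ` for the variables of `Γ`. -/
def ctxSub : (Γ : List (Ty S)) → Sub [ctxTy Γ] Γ
  | _ :: _, _, .z => .snd (.var .z)
  | _ :: Γ, _, .s v => (ctxSub Γ v).subst (.one (.fst (.var .z)))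

/-- A sequent `Γ ∣ Φ ⊢ ψ` in an arbitrary context is satisfied if the sequent over the product of
the types in `Γ` that corresponds to it is satisfied. -/
def SatisfiesCtx (Q : Dᵒᵖ ⥤ HeytAlg.{u}) (M : Ty S ⥤ D) (μ : termDoctrine S ⟶ M.op ⋙ Q)
    (Γ : List (Ty S)) (Φ : List (Fm Γ)) (ψ : Fm Γ) : Prop :=
  Satisfies Q M μ (ctxTy Γ) (Φ.map fun φ => φ.subst (ctxSub Γ)) (ψ.subst (ctxSub Γ))

/-- The natural transformation of the generic model, with identity components. -/
def genericTrans (S : Signature.{u}) : termDoctrine S ⟶ (𝟭 (Ty S)).op ⋙ termDoctrine S where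
  app σ := 𝟙 ((termDoctrine S).obj σ)

end Models

end SLCS

namespace SLCS

variable {S : Signature.{u}}

/-! ### Derived rules -/

/-! Each clause in the definition of an elementary closure hyperdoctrine is the invariant form of a
rule of the calculus, so the structure on the doctrine of terms can be read off from derivability.
The work lies in a mismatch of contexts: the fibre over `σ × τ` consists of formulae in one variable
of product type, whereas binders act on a context of two variables. Substituting the pair of two
variables, and conversely the two projections, are mutually inverse up to provable equality; on
sequents this is `Der.pair_iff`.

Through this dictionary β and η give currying (`curryEquiv`), and the rules for `∃` and `∀` become
adjunctions to reindexing along a projection (`Der.exPair_iff`, `Der.allPair_iff`). Beck–Chevalley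
says that substitution commutes with binders, and Frobenius follows formally from preservation of
implication. Replacement makes `=` a fibered equality (`isFiberedEquality_term`), and the first two
rules for `C` make it a closure operator.

Soundness needs no induction on derivations, so the infinitary rule for `U` never has to be
interpreted: derivability is the order of the fibres, satisfaction is an inequality between images
under `μ`, and `μ` is fibrewise a Heyting homomorphism (`satisfies_of_der`). Completeness holds
because the identities form a model in which satisfaction is derivability itself
(`satisfies_generic_iff`). Arbitrary contexts are reduced to a single variable by `Der.ctx_iff`. -/

theorem Tm.lift_inst {Γ Δ : List (Ty S)} {σ τ : Ty S} (M : Tm (σ :: Γ) τ) (s : Sub Δ Γ)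
    (N : Tm Δ σ) : (M.subst (s.lift σ)).inst N = M.subst (s.cons N) := by
  rw [Tm.inst, Tm.subst_subst]
  congr 1
  funext τ v
  cases v with
  | z => rfl
  | s v => exact Tm.wk_inst (s v) N

/-- The quantifier rules weaken by a renaming, whereas `Der.subst` transports sequents along
substitutions only; this passes between the two. -/
theorem Tm.wk_eq_subst {Γ : List (Ty S)} {τ : Ty S} (M : Tm Γ τ) (σ : Ty S) :
    M.wk σ = M.subst fun _ v => .var (.s v) := by
  have h := Tm.ren_subst M (fun _ v => .var v) (fun _ v => .s v : Ren (σ :: Γ) Γ)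
  rwa [Tm.subst_var] at h

/-- Opening a binder: a bound variable instantiated by a fresh one gives back the body. This is what
inverts the quantifier rules. -/
theorem Tm.lift_wk_inst {Γ : List (Ty S)} {σ τ : Ty S} (M : Tm (σ :: Γ) τ) :
    (M.subst (Sub.lift (fun _ v => .var (.s v) : Sub (σ :: Γ) Γ) σ)).inst (.var .z) = M := by
  rw [Tm.lift_inst]
  have e : Sub.cons (fun _ v => .var (.s v)) (.var .z) =
      (fun _ v => .var v : Sub (σ :: Γ) (σ :: Γ)) := by
    funext τ v
    cases v <;> rfl
  rw [e, Tm.subst_var]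

theorem Tm.subst_nil {Δ : List (Ty S)} {τ : Ty S} (M : Tm [] τ) (s t : Sub Δ []) :
    M.subst s = M.subst t := by
  congr 1
  funext τ v
  cases v

theorem Tm.subst_one_subst {σ τ : Ty S} {Δ E : List (Ty S)} (M : Tm [σ] τ) (N : Tm Δ σ)
    (t : Sub E Δ) : (M.subst (.one N)).subst t = M.subst (.one (N.subst t)) := by
  rw [Tm.subst_subst, Sub.one_comp]

theorem Tm.subst_one_wk {σ τ ρ : Ty S} {Δ : List (Ty S)} (M : Tm [σ] τ) (N : Tm Δ σ) :
    (M.subst (.one N)).wk ρ = M.subst (.one (N.wk ρ)) := by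
  rw [Tm.wk, Tm.ren_subst]
  congr 1
  funext τ v
  cases v with
  | z => rfl
  | s v => cases v

theorem Tm.subst_one_var {σ τ : Ty S} (M : Tm [σ] τ) : M.subst (.one (.var .z)) = M := by
  rw [Sub.one_var, Tm.subst_var]

theorem Tm.wk_eq_subst_one {σ τ ρ : Ty S} (M : Tm [σ] τ) :
    M.wk ρ = M.subst (.one (.var (.s .z))) := by
  have h := M.subst_one_wk (ρ := ρ) (.var (.z : Var [σ] σ))
  rwa [M.subst_one_var] at h

/-! ### Congruence of provable equality -/

theorem Der.congr_pair {Γ : List (Ty S)} {σ τ : Ty S} {Φ : List (Fm Γ)} {M M' : Tm Γ σ}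
    {N N' : Tm Γ τ} (hM : Der Γ Φ (.eq M M')) (hN : Der Γ Φ (.eq N N')) :
    Der Γ Φ (.eq (.pair M N) (.pair M' N')) := by
  have h₁ := hM.eq_congr (.pair (.var .z) (N.wk σ))
  have h₂ := hN.eq_congr (.pair (M'.wk τ) (.var .z))
  have e₁ : ∀ P, Tm.inst (.pair (.var .z) (N.wk σ)) P = .pair P N := fun P => by
    change Tm.pair P ((N.wk σ).inst P) = _
    rw [Tm.wk_inst]
  have e₂ : ∀ P, Tm.inst (.pair (M'.wk τ) (.var .z)) P = .pair M' P := fun P => by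
    change Tm.pair ((M'.wk τ).inst P) P = _
    rw [Tm.wk_inst]
  rw [e₁, e₁] at h₁
  rw [e₂, e₂] at h₂
  exact h₁.eq_trans h₂

/-- The one-variable congruence, applied to `π₁(p) π₂(p)` at a pair, replaces function and argument
together; `e` then reduces the projections. -/
theorem Der.congr_app {Γ : List (Ty S)} {σ τ : Ty S} {Φ : List (Fm Γ)} {M M' : Tm Γ (.arr σ τ)}
    {N N' : Tm Γ σ} (hM : Der Γ Φ (.eq M M')) (hN : Der Γ Φ (.eq N N')) :
    Der Γ Φ (.eq (.app M N) (.app M' N')) := by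
  have h := Der.congr_one (.app (.fst (.var .z)) (.snd (.var .z))) (Der.congr_pair hM hN)
  have e : ∀ (P : Tm Γ (.arr σ τ)) (Q : Tm Γ σ),
      Der Γ Φ (.eq (.app (.fst (.pair P Q)) (.snd (.pair P Q))) (.app P Q)) := fun P Q => by
    have h₁ := (Der.fst_pair (Φ := Φ) P Q).eq_congr (.app (.var .z) ((Tm.snd (.pair P Q)).wk _))
    have h₂ := (Der.snd_pair (Φ := Φ) P Q).eq_congr (.app (P.wk _) (.var .z))
    have e₁ : ∀ R, Tm.inst (.app (.var .z) ((Tm.snd (.pair P Q)).wk (.arr σ τ))) R =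
        .app R (.snd (.pair P Q)) := fun R => by
      change Tm.app R (((Tm.snd (.pair P Q)).wk _).inst R) = _
      rw [Tm.wk_inst]
    have e₂ : ∀ R, Tm.inst (.app (P.wk σ) (.var .z)) R = .app P R := fun R => by
      change Tm.app ((P.wk _).inst R) R = _
      rw [Tm.wk_inst]
    rw [e₁, e₁] at h₁
    rw [e₂, e₂] at h₂
    exact h₁.eq_trans h₂
  exact (e M N).eq_symm.eq_trans (Der.eq_trans h (e M' N'))

/-- Pointwise provably equal substitutions give provably equal terms. -/
theorem Der.congr_subst {Γ Δ : List (Ty S)} {τ : Ty S} {Φ : List (Fm Δ)} (M : Tm Γ τ)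
    (s t : Sub Δ Γ) (h : ∀ ⦃σ : Ty S⦄ (v : Var Γ σ), Der Δ Φ (.eq (s v) (t v))) :
    Der Δ Φ (.eq (M.subst s) (M.subst t)) := by
  induction Γ generalizing τ with
  | nil =>
    rw [M.subst_nil s t]
    exact .eq_refl _
  | cons σ Γ ih =>
    -- By β, the first variable can be split off: `M[s]` is `λx.M`, under the tail of `s`, applied
    -- to the head of `s`. The induction on the context thus applies to `λx.M`, which has one free
    -- variable fewer, and no recursion on terms is needed.
    have key : ∀ s : Sub Δ (σ :: Γ), Der Δ Φ (.eq
        (.app ((Tm.lam M).subst fun _ v => s (.s v)) (s .z)) (M.subst s)) := fun s => by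
      have hb := Der.beta (Φ := Φ) (M.subst (Sub.lift (fun _ v => s (.s v)) σ)) (s .z)
      rw [Tm.lift_inst] at hb
      have hs : Sub.cons (fun _ v => s (.s v)) (s .z) = s := by
        funext τ v
        cases v <;> rfl
      rw [hs] at hb
      exact hb
    have hl := ih (.lam M) (fun _ v => s (.s v)) (fun _ v => t (.s v)) fun _ v => h (.s v)
    exact (key s).eq_symm.eq_trans ((Der.congr_app hl (h .z)).eq_trans (key t))

/-- This reduces a finite set of hypotheses to one, which is the form of sequent that the order of
the fibres expresses. -/
theorem Der.conj {Γ : List (Ty S)} {Φ : List (Fm Γ)} {ψ : Fm Γ} :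
    Der Γ [Φ.foldr .and .top] ψ ↔ Der Γ Φ ψ := by
  have h₁ : ∀ Φ : List (Fm Γ), Der Γ Φ (Φ.foldr .and .top) := by
    intro Φ
    induction Φ with
    | nil => exact .top_intro
    | cons φ Φ ih => exact .and_intro (.ax (by simp)) (.weak (by simp) ih)
  have h₂ : ∀ (Φ : List (Fm Γ)) (φ : Fm Γ), φ ∈ Φ → Der Γ [Φ.foldr .and .top] φ := by
    intro Φ
    induction Φ with
    | nil => simp
    | cons χ Φ ih =>
      intro φ hφ
      rcases List.mem_cons.1 hφ with rfl | hφ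
      · exact .and_left (.ax (List.mem_singleton_self _))
      · exact (ih φ hφ).mp (.and_right (.ax (List.mem_singleton_self _)))
  -- Iterated cut: hypotheses that all follow from `Ψ` can be discharged one by one.
  have h₃ : ∀ (Φ Ψ : List (Fm Γ)) (ψ : Fm Γ), (∀ φ ∈ Φ, Der Γ Ψ φ) → Der Γ (Φ ++ Ψ) ψ →
      Der Γ Ψ ψ := by
    intro Φ
    induction Φ with
    | nil => exact fun _ _ _ h => h
    | cons φ Φ ih =>
      intro Ψ ψ h h'
      exact ih Ψ ψ (fun χ hχ => h χ (List.mem_cons_of_mem _ hχ))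
        (.cut (.weak (List.subset_append_right _ _) (h φ List.mem_cons_self)) h')
  exact ⟨fun h => h.mp (h₁ Φ),
    fun h => h₃ Φ _ ψ (h₂ Φ) (.weak (List.subset_append_left _ _) h)⟩

/-! ### Sequents over the product of a context -/

/-- The tuple of the variables of a context. -/
def ctxTuple : (Γ : List (Ty S)) → Tm Γ (ctxTy Γ)
  | [] => .star
  | σ :: Γ => .pair ((ctxTuple Γ).wk σ) (.var .z)

theorem ctxSub_ctxTuple {Γ : List (Ty S)} {τ : Ty S} {Φ : List (Fm Γ)} (v : Var Γ τ) :
    Der Γ Φ (.eq ((ctxSub Γ v).subst (.one (ctxTuple Γ))) (.var v)) := by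
  -- The hypotheses are dropped first, since the induction hypothesis is carried to the larger
  -- context by `Der.subst`, which would alter them.
  refine Der.nil ?_
  clear Φ
  induction v with
  | z => exact Der.snd_pair _ _
  | @s Γ τ σ v ih =>
    change Der _ [] (.eq (((ctxSub Γ v).subst (.one (.fst (.var .z)))).subst
      (.one (.pair ((ctxTuple Γ).wk σ) (.var .z)))) _)
    rw [Tm.subst_one_subst]
    refine Der.eq_trans (Der.congr_one _ (Der.fst_pair _ _)) ?_
    have h := Der.subst (fun _ v => .var (.s v) : Sub (σ :: Γ) Γ) ih
    change Der _ [] (.eq (((ctxSub Γ v).subst (.one (ctxTuple Γ))).subst _) (.var (.s v))) at h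
    rw [Tm.subst_one_subst] at h
    rw [Tm.wk_eq_subst]
    exact h

/-- Right to left is an instance of substitution. For the converse the tuple of variables is
substituted back: the projections of the tuple are provably the variables, so every formula returns
to itself up to provable equality. -/
theorem Der.ctx_iff {Γ : List (Ty S)} {Φ : List (Fm Γ)} {ψ : Fm Γ} :
    Der [ctxTy Γ] (Φ.map fun φ => φ.subst (ctxSub Γ)) (ψ.subst (ctxSub Γ)) ↔ Der Γ Φ ψ := by
  refine ⟨fun h => ?_, fun h => .subst _ h⟩
  have key : ∀ (φ : Fm Γ) (Ψ : List (Fm Γ)),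
      Der Γ Ψ (.eq ((φ.subst (ctxSub Γ)).subst (.one (ctxTuple Γ))) φ) := fun φ Ψ => by
    rw [Tm.subst_subst]
    have h := Der.congr_subst (Φ := Ψ) φ (fun _ v => (ctxSub Γ v).subst (.one (ctxTuple Γ)))
      (fun _ v => .var v) fun _ v => ctxSub_ctxTuple v
    rwa [φ.subst_var] at h
  -- Both lists of hypotheses are folded into conjunctions, which are then compared conjunct by
  -- conjunct.
  refine (key ψ Φ).eq_mp (Der.conj.1 ?_)
  have h' := Der.conj.2 (Der.subst (.one (ctxTuple Γ)) h)
  refine h'.mp ?_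
  clear h h'
  induction Φ with
  | nil => exact .top_intro
  | cons φ Φ ih =>
    exact .and_intro ((key φ _).eq_symm.eq_mp (.and_left (.ax (List.mem_singleton_self _))))
      (ih.mp (.and_right (.ax (List.mem_singleton_self _))))

end SLCS

namespace SLCS

variable {S : Signature.{u}}

/-! ### Products and exponentials in the classifying category -/

theorem fst_eq_hom (σ τ : Ty S) : fst σ τ = hom (.fst (.var .z)) := rfl

theorem snd_eq_hom (σ τ : Ty S) : snd σ τ = hom (.snd (.var .z)) := rfl

theorem hom_eq {σ τ : Ty S} {M N : Tm [σ] τ} (h : Der [σ] [] (.eq M N)) : hom M = hom N :=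
  Quotient.sound h

theorem hom_surj {σ τ : Ty S} (f : σ ⟶ τ) : ∃ M : Tm [σ] τ, hom M = f :=
  Quotient.exists_rep f

theorem lift_hom {ρ σ τ : Ty S} (M : Tm [ρ] σ) (N : Tm [ρ] τ) :
    lift (hom M) (hom N) = hom (.pair M N) :=
  CartesianMonoidalCategory.hom_ext _ _
    ((lift_fst _ _).trans (hom_eq (Der.fst_pair M N)).symm)
    ((lift_snd _ _).trans (hom_eq (Der.snd_pair M N)).symm)

theorem whiskerLeft_hom (ρ : Ty S) {σ τ : Ty S} (M : Tm [σ] τ) :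
    ρ ◁ hom M = hom (.pair (.fst (.var .z)) (M.subst (.one (.snd (.var .z))))) := by
  rw [← lift_hom]
  exact CartesianMonoidalCategory.hom_ext _ _ ((whiskerLeft_fst _ _).trans (lift_fst _ _).symm)
    ((whiskerLeft_snd _ _).trans (lift_snd _ _).symm)

/-- The pair of the two variables of a context. -/
abbrev pairVar (σ τ : Ty S) : Tm [σ, τ] (.prod σ τ) := .pair (.var .z) (.var (.s .z))

/-- Substitution of a pair of two terms for a pair of two variables. -/
theorem Tm.subst_pairVar {σ τ ρ : Ty S} {Δ : List (Ty S)} (M : Tm [.prod σ τ] ρ)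
    (s : Sub Δ [σ, τ]) :
    (M.subst (.one (pairVar σ τ))).subst s = M.subst (.one (.pair (s .z) (s (.s .z)))) :=
  M.subst_one_subst _ _

/-- Surjective pairing. It makes substitution of the projections undo substitution of `pairVar`. -/
theorem Der.subst_proj {σ τ ρ : Ty S} {Φ : List (Fm [.prod σ τ])} (M : Tm [.prod σ τ] ρ) :
    Der _ Φ (.eq (M.subst (.one (.pair (.fst (.var .z)) (.snd (.var .z))))) M) := by
  have h := Der.congr_one M (Der.pair_eta (Φ := Φ) (.var .z))
  rwa [Tm.subst_one_var] at h

/-- Weakening along the second projection, in the context of the components. -/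
theorem Der.subst_snd_pairVar {σ τ ρ : Ty S} {Φ : List (Fm [σ, τ])} (M : Tm [τ] ρ) :
    Der [σ, τ] Φ (.eq ((M.subst (.one (.snd (.var .z)))).subst (.one (pairVar σ τ))) (M.wk σ)) := by
  rw [Tm.subst_one_subst, Tm.wk_eq_subst_one]
  exact Der.congr_one M (Der.snd_pair _ _)

/-- Currying of terms. -/
def Tm.curry {σ τ ρ : Ty S} (M : Tm [.prod σ τ] ρ) : Tm [τ] (.arr σ ρ) :=
  .lam (M.subst (.one (pairVar σ τ)))

/-- Uncurrying of terms. -/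
def Tm.uncurry {σ τ ρ : Ty S} (M : Tm [τ] (.arr σ ρ)) : Tm [.prod σ τ] ρ :=
  .app (M.subst (.one (.snd (.var .z)))) (.fst (.var .z))

/-- The rule β followed by surjective pairing. -/
theorem Tm.uncurry_curry {σ τ ρ : Ty S} (M : Tm [.prod σ τ] ρ) :
    Der [.prod σ τ] [] (.eq M.curry.uncurry M) := by
  have h := Der.beta (Γ := [.prod σ τ]) (Φ := []) ((M.subst (.one (pairVar σ τ))).subst
    (Sub.lift (.one (.snd (.var .z))) σ)) (.fst (.var .z))
  rw [Tm.lift_inst] at h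
  refine h.eq_trans ?_
  rw [Tm.subst_pairVar]
  exact Der.subst_proj M

/-- Under the `λ` the projections of the pair of variables reduce, which leaves the η-expansion of
`M`. -/
theorem Tm.curry_uncurry {σ τ ρ : Ty S} (M : Tm [τ] (.arr σ ρ)) :
    Der [τ] [] (.eq M.uncurry.curry M) := by
  refine Der.eq_trans (Der.xi ?_) (Der.eta M)
  change Der _ _ (.eq (.app ((M.subst (.one (.snd (.var .z)))).subst _) (.fst (pairVar σ τ))) _)
  rw [Tm.subst_one_subst, Tm.wk_eq_subst_one]
  exact Der.congr_app (Der.congr_one M (Der.snd_pair _ _)) (Der.fst_pair _ _)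

theorem Der.curry {σ τ ρ : Ty S} {M N : Tm [.prod σ τ] ρ} (h : Der _ [] (.eq M N)) :
    Der _ [] (.eq M.curry N.curry) :=
  .xi (.subst (.one (pairVar σ τ)) h)

theorem Der.uncurry {σ τ ρ : Ty S} {M N : Tm [τ] (.arr σ ρ)} (h : Der _ [] (.eq M N)) :
    Der _ [] (.eq M.uncurry N.uncurry) :=
  Der.congr_app (.subst (.one (.snd (.var .z))) h) (.eq_refl _)

/-- Morphisms `σ × τ ⟶ ρ` correspond to morphisms `τ ⟶ (σ → ρ)`. -/
def curryEquiv (σ τ ρ : Ty S) : (σ ⊗ τ ⟶ ρ) ≃ (τ ⟶ Ty.arr σ ρ) where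
  toFun := Quotient.map Tm.curry fun _ _ h => Der.curry h
  invFun := Quotient.map Tm.uncurry fun _ _ h => Der.uncurry h
  left_inv f := by
    obtain ⟨M, rfl⟩ := hom_surj f
    exact hom_eq M.uncurry_curry
  right_inv f := by
    obtain ⟨M, rfl⟩ := hom_surj f
    exact hom_eq M.curry_uncurry

/-- Naturality in this one variable suffices: it determines the action of `σ → -` on morphisms and
makes it right adjoint to `σ × -`. -/
theorem curryEquiv_naturality (σ : Ty S) {τ τ' ρ : Ty S} (f : τ' ⟶ τ) (g : σ ⊗ τ ⟶ ρ) :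
    curryEquiv σ τ' ρ (σ ◁ f ≫ g) = f ≫ curryEquiv σ τ ρ g := by
  obtain ⟨M, rfl⟩ := hom_surj f
  obtain ⟨N, rfl⟩ := hom_surj g
  rw [whiskerLeft_hom]
  refine hom_eq (Der.xi ?_)
  rw [Tm.subst_one_subst, Tm.subst_pairVar]
  refine Der.congr_one N (Der.congr_pair (Der.fst_pair _ _) ?_)
  exact Der.subst_snd_pairVar M

/-- The classifying category is cartesian closed. -/
@[reducible]
def monoidalClosedTy : MonoidalClosed (Ty S) where
  closed σ :=
    { rightAdj := Adjunction.rightAdjointOfEquiv (F := tensorLeft σ) (G_obj := Ty.arr σ)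
        (fun τ ρ => curryEquiv σ τ ρ) fun _ _ _ f g => curryEquiv_naturality σ f g
      adj := Adjunction.adjunctionOfEquivRight _ _ }

/-! ### Quantifiers and equality -/

theorem pred_surj {σ : Ty S} (a : (termDoctrine S).obj (op σ)) : ∃ φ : Fm [σ], pred φ = a :=
  Quotient.exists_rep a

theorem pred_le_iff {σ : Ty S} {φ ψ : Fm [σ]} : pred φ ≤ pred ψ ↔ Der [σ] [φ] ψ := Iff.rfl

/-- The formula `∃ x : σ, φ(x, y)`. -/
def Tm.exPair {σ τ : Ty S} (φ : Fm [.prod σ τ]) : Fm [τ] := .ex (φ.subst (.one (pairVar σ τ)))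

/-- The formula `∀ x : σ, φ(x, y)`. -/
def Tm.allPair {σ τ : Ty S} (φ : Fm [.prod σ τ]) : Fm [τ] := .all (φ.subst (.one (pairVar σ τ)))

/-- A sequent over `σ × τ` is derivable iff it is derivable in the context of the components. -/
theorem Der.pair_iff {σ τ : Ty S} {φ ψ : Fm [.prod σ τ]} :
    Der [σ, τ] [φ.subst (.one (pairVar σ τ))] (ψ.subst (.one (pairVar σ τ))) ↔
      Der [.prod σ τ] [φ] ψ := by
  refine ⟨fun h => ?_, fun h => .subst _ h⟩
  have h' := Der.subst (Sub.cons (.one (.snd (.var .z))) (.fst (.var .z)) :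
    Sub [.prod σ τ] [σ, τ]) h
  simp only [List.map_cons, List.map_nil, Tm.subst_pairVar] at h'
  exact (Der.subst_proj ψ).eq_mp (h'.mp ((Der.subst_proj φ).eq_symm.eq_mp (.ax (by simp))))

/-- The two rules for `∃` merged into one reversible rule. From left to right, the sequent is
weakened and the fresh variable serves as the witness. -/
theorem Der.ex_iff {Γ : List (Ty S)} {σ : Ty S} {φ : Fm (σ :: Γ)} {ψ : Fm Γ} :
    Der Γ [.ex φ] ψ ↔ Der (σ :: Γ) [φ] (ψ.wk σ) := by
  refine ⟨fun h => ?_, fun h => .ex_elim (.ax (List.mem_singleton_self _)) (.weak (by simp) h)⟩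
  have h' := Der.subst (fun _ v => .var (.s v) : Sub (σ :: Γ) Γ) h
  rw [← Tm.wk_eq_subst] at h'
  refine h'.mp (.ex_intro (.var .z) ?_)
  rw [Tm.lift_wk_inst]
  exact .ax (by simp)

theorem Der.all_iff {Γ : List (Ty S)} {σ : Ty S} {φ : Fm (σ :: Γ)} {ψ : Fm Γ} :
    Der Γ [ψ] (.all φ) ↔ Der (σ :: Γ) [ψ.wk σ] φ := by
  refine ⟨fun h => ?_, fun h => .all_intro h⟩
  have h' := Der.all_elim (.var .z) (Der.subst (fun _ v => .var (.s v) : Sub (σ :: Γ) Γ) h)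
  rw [Tm.lift_wk_inst] at h'
  rw [Tm.wk_eq_subst]
  exact h'

/-- The adjunction of `∃` with reindexing: in the context of the components, the formula reindexed
along the second projection is provably the weakened one, so the reversible rule for `∃` applies. -/
theorem Der.exPair_iff {σ τ : Ty S} {φ : Fm [.prod σ τ]} {ψ : Fm [τ]} :
    Der [τ] [φ.exPair] ψ ↔ Der [.prod σ τ] [φ] (ψ.subst (.one (.snd (.var .z)))) := by
  rw [← Der.pair_iff]
  exact Der.ex_iff.trans ⟨fun h => (Der.subst_snd_pairVar ψ).eq_symm.eq_mp h,
    fun h => (Der.subst_snd_pairVar ψ).eq_mp h⟩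

theorem Der.allPair_iff {σ τ : Ty S} {φ : Fm [.prod σ τ]} {ψ : Fm [τ]} :
    Der [τ] [ψ] φ.allPair ↔ Der [.prod σ τ] [ψ.subst (.one (.snd (.var .z)))] φ := by
  rw [← Der.pair_iff]
  exact Der.all_iff.trans
    ⟨fun h => h.mp ((Der.subst_snd_pairVar ψ).eq_mp (.ax (List.mem_singleton_self _))),
      fun h => h.mp ((Der.subst_snd_pairVar ψ).eq_symm.eq_mp (.ax (List.mem_singleton_self _)))⟩

theorem Der.exPair_mono {σ τ : Ty S} {φ ψ : Fm [.prod σ τ]} (h : Der _ [φ] ψ) :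
    Der _ [φ.exPair] ψ.exPair :=
  Der.exPair_iff.2 (Der.mp (Der.exPair_iff.1 (.ax (by simp))) h)

theorem Der.allPair_mono {σ τ : Ty S} {φ ψ : Fm [.prod σ τ]} (h : Der _ [φ] ψ) :
    Der _ [φ.allPair] ψ.allPair :=
  Der.allPair_iff.2 (Der.mp h (Der.allPair_iff.1 (.ax (by simp))))

/-- Existential quantification of predicates along the second projection. -/
def exPred (σ τ : Ty S) :
    (termDoctrine S).obj (op (σ ⊗ τ)) → (termDoctrine S).obj (op τ) :=
  Quotient.map (sa := termSetoid (.prod σ τ) (.prop S)) (sb := termSetoid τ (.prop S)) Tm.exPair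
    fun _ _ h => .prop_ext (Der.exPair_mono (Der.eq_iff.1 h).1) (Der.exPair_mono (Der.eq_iff.1 h).2)

/-- Universal quantification of predicates along the second projection. -/
def allPred (σ τ : Ty S) :
    (termDoctrine S).obj (op (σ ⊗ τ)) → (termDoctrine S).obj (op τ) :=
  Quotient.map (sa := termSetoid (.prod σ τ) (.prop S)) (sb := termSetoid τ (.prop S)) Tm.allPair
    fun _ _ h =>
      .prop_ext (Der.allPair_mono (Der.eq_iff.1 h).1) (Der.allPair_mono (Der.eq_iff.1 h).2)

theorem exPred_gc (σ τ : Ty S) :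
    GaloisConnection (exPred σ τ) ((termDoctrine S).map (snd σ τ).op) := fun a b => by
  obtain ⟨φ, rfl⟩ := pred_surj a
  obtain ⟨ψ, rfl⟩ := pred_surj b
  exact Der.exPair_iff

theorem allPred_gc (σ τ : Ty S) :
    GaloisConnection ((termDoctrine S).map (snd σ τ).op) (allPred σ τ) := fun a b => by
  obtain ⟨φ, rfl⟩ := pred_surj a
  obtain ⟨ψ, rfl⟩ := pred_surj b
  exact Der.allPair_iff.symm

/-- Reindexing along `1 × M`, in the context of the components. -/
theorem Der.subst_whisker_pairVar {σ τ τ' ρ : Ty S} {Φ : List (Fm [σ, τ'])} (M : Tm [τ'] τ)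
    (N : Tm [.prod σ τ] ρ) :
    Der [σ, τ'] Φ (.eq ((N.subst (.one (.pair (.fst (.var .z))
        (M.subst (.one (.snd (.var .z))))))).subst (.one (pairVar σ τ')))
      ((N.subst (.one (pairVar σ τ))).subst (Sub.lift (.one M) σ))) := by
  rw [Tm.subst_one_subst, Tm.subst_pairVar]
  exact Der.congr_one N (Der.congr_pair (Der.fst_pair _ _) (Der.subst_snd_pairVar M))

theorem Der.ex_mono {Γ : List (Ty S)} {σ : Ty S} {φ ψ : Fm (σ :: Γ)} (h : Der _ [φ] ψ) :
    Der Γ [.ex φ] (.ex ψ) :=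
  Der.ex_iff.2 ((Der.ex_iff.1 (.ax (by simp))).mp h)

theorem Der.all_mono {Γ : List (Ty S)} {σ : Ty S} {φ ψ : Fm (σ :: Γ)} (h : Der _ [φ] ψ) :
    Der Γ [.all φ] (.all ψ) :=
  Der.all_iff.2 (h.mp (Der.all_iff.1 (.ax (by simp))))

/-- Substitution passes under the binder by definition. The two bodies then differ only by
projections of pairs, and `∃` is monotone in its body. -/
theorem exPred_beckChevalley (σ : Ty S) {τ τ' : Ty S} (f : τ' ⟶ τ)
    (a : (termDoctrine S).obj (op (σ ⊗ τ))) :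
    exPred σ τ' ((termDoctrine S).map (σ ◁ f).op a) =
      (termDoctrine S).map f.op (exPred σ τ a) := by
  obtain ⟨M, rfl⟩ := hom_surj f
  obtain ⟨φ, rfl⟩ := pred_surj a
  rw [whiskerLeft_hom]
  have h := Der.eq_iff.1 (Der.subst_whisker_pairVar (Φ := []) M φ)
  exact le_antisymm (Der.ex_mono h.1) (Der.ex_mono h.2)

theorem allPred_beckChevalley (σ : Ty S) {τ τ' : Ty S} (f : τ' ⟶ τ)
    (a : (termDoctrine S).obj (op (σ ⊗ τ))) :
    allPred σ τ' ((termDoctrine S).map (σ ◁ f).op a) =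
      (termDoctrine S).map f.op (allPred σ τ a) := by
  obtain ⟨M, rfl⟩ := hom_surj f
  obtain ⟨φ, rfl⟩ := pred_surj a
  rw [whiskerLeft_hom]
  have h := Der.eq_iff.1 (Der.subst_whisker_pairVar (Φ := []) M φ)
  exact le_antisymm (Der.all_mono h.1) (Der.all_mono h.2)

/-- Frobenius reciprocity holds for every left adjoint of a morphism of Heyting algebras. -/
theorem frobenius_of_gc {A B : Type*} [HeytingAlgebra A] [HeytingAlgebra B] {e : B → A} {m : A → B}
    (gc : GaloisConnection e m) (hm : ∀ a b, m (a ⇨ b) = m a ⇨ m b) (a : A) (b : B) :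
    e (m a ⊓ b) = a ⊓ e b := by
  apply le_antisymm
  · exact le_inf (gc.l_le inf_le_left) (gc.monotone_l inf_le_right)
  · rw [inf_comm, ← le_himp_iff, gc.le_iff_le, hm, le_himp_iff, inf_comm]
    exact gc.le_u_l _

/-! ### The axioms of an elementary closure hyperdoctrine -/

theorem isHyperdoctrine_term (S : Signature.{u}) : IsHyperdoctrine (termDoctrine S) where
  exists_ex := ⟨exPred, exPred_gc, fun σ _ _ f a => exPred_beckChevalley σ f a,
    fun σ τ a b => frobenius_of_gc (exPred_gc σ τ)
      ((Term.reindex (snd σ τ)).map_himp') a b⟩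
  exists_all := ⟨allPred, allPred_gc, fun σ _ _ f a => allPred_beckChevalley σ f a⟩

/-- The content is that `φ(x, y) ∧ y = z ⊢ ψ(x, y, z)` holds iff `φ(x, y) ⊢ ψ(x, y, y)` does:
reflexivity gives one direction, replacement the other. -/
theorem isFiberedEquality_term (σ : Ty S) : IsFiberedEquality (termDoctrine S) σ
    (pred (σ := .prod σ σ) (.eq (.fst (.var .z)) (.snd (.var .z)))) := fun ρ a b => by
  obtain ⟨φ, rfl⟩ := pred_surj a
  obtain ⟨ψ, rfl⟩ := pred_surj b
  have hl : lift (𝟙 σ) (𝟙 σ) = hom (.pair (.var .z) (.var .z)) := lift_hom _ _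
  rw [hl, fst_eq_hom, snd_eq_hom, whiskerLeft_hom, whiskerLeft_hom]
  change Der [.prod ρ (.prod σ σ)] [.and (φ.subst (.one (.pair (.fst (.var .z))
      (.fst (.snd (.var .z))))))
    (.eq (.fst (.snd (.var .z))) (.snd (.snd (.var .z))))] ψ ↔
    Der [.prod ρ σ] [φ] (ψ.subst (.one (.pair (.fst (.var .z))
      (.pair (.snd (.var .z)) (.snd (.var .z))))))
  constructor
  -- Substitute `(x, (y, y))`: both sides of the equation reduce to `y`, so the equality hypothesis
  -- becomes provable.
  · intro h
    have h' := Der.subst (.one (.pair (.fst (.var .z)) (.pair (.snd (.var .z)) (.snd (.var .z)))) :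
      Sub [.prod ρ σ] [.prod ρ (.prod σ σ)]) h
    have hs := Der.snd_pair (Φ := [φ]) (.fst (.var .z)) (.pair (.snd (.var .z)) (.snd (.var .z)))
    have h₁ := (Der.congr_one (.fst (.var .z)) hs).eq_trans (Der.fst_pair _ _)
    have h₂ := (Der.congr_one (.snd (.var .z)) hs).eq_trans (Der.snd_pair _ _)
    refine h'.mp (.and_intro ?_ (h₁.eq_trans h₂.eq_symm))
    rw [Tm.subst_one_subst]
    exact Der.eq_mp ((Der.congr_one φ (Der.congr_pair (Der.fst_pair _ _) h₁)).eq_trans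
      (Der.subst_proj φ)).eq_symm (.ax (by simp))
  -- Substitute `(x, y)`, forgetting `z`; this yields `ψ(x, y, y)`, whose last argument must still
  -- be changed.
  · intro h
    have h' := Der.subst (.one (.pair (.fst (.var .z)) (.fst (.snd (.var .z)))) :
      Sub [.prod ρ (.prod σ σ)] [.prod ρ σ]) h
    rw [Tm.subst_one_subst] at h'
    refine Der.eq_mp ?_ (h'.mp (.and_left (.ax (List.mem_singleton_self _))))
    refine Der.eq_trans (Der.congr_one ψ ?_) (Der.subst_proj ψ)
    refine Der.congr_pair (Der.fst_pair _ _) (Der.eq_trans (Der.congr_pair (Der.snd_pair _ _)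
      (Der.eq_trans (Der.snd_pair _ _) ?_)) (Der.pair_eta _))
    -- Here the hypothesis `y = z` enters, replacing the second copy of `y`.
    exact .and_right (.ax (List.mem_singleton_self _))

theorem isClosureOperator_term (S : Signature.{u}) :
    IsClosureOperator (termDoctrine S) (termClosure S) where
  monotone σ a b h := by
    obtain ⟨φ, rfl⟩ := pred_surj a
    obtain ⟨ψ, rfl⟩ := pred_surj b
    exact Der.cl_two h
  inflationary σ a := by
    obtain ⟨φ, rfl⟩ := pred_surj a
    exact Der.cl_one (.ax (by simp))
  continuous f a := by
    obtain ⟨M, rfl⟩ := hom_surj f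
    obtain ⟨φ, rfl⟩ := pred_surj a
    -- Continuity holds with equality, since substitution commutes with `C` by definition.
    exact le_refl (pred (.cl (φ.subst (.one M))))

theorem isElementaryClosureHyperdoctrine_term (S : Signature.{u}) :
    IsElementaryClosureHyperdoctrine (termDoctrine S) (termClosure S) where
  hyperdoctrine := isHyperdoctrine_term S
  elementary σ := ⟨_, isFiberedEquality_term σ⟩
  closure := isClosureOperator_term S

/-! ### The generic model -/

/-- Left adjoints are unique. Over the terminal object, the one attached to `δ` sends `⊤` to `δ`
reindexed along `1 × (X × X) ⟶ X × X`, and a section of this projection recovers `δ`. -/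
theorem IsFiberedEquality.unique {C : Type*} [Category.{u} C] [CartesianMonoidalCategory C]
    {P : Cᵒᵖ ⥤ HeytAlg.{u}} {X : C} {δ δ' : P.obj (op (X ⊗ X))} (h : IsFiberedEquality P X δ)
    (h' : IsFiberedEquality P X δ') : δ = δ' := by
  have e := (h (𝟙_ C)).l_unique (h' (𝟙_ C)) (fun _ => rfl) (b := ⊤)
  simp only [map_top, top_inf_eq] at e
  have e' := congrArg (P.map (lift (toUnit _) (𝟙 _)).op) e
  simp only [← ConcreteCategory.comp_apply, ← P.map_comp, ← op_comp, lift_snd, op_id, P.map_id,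
    ConcreteCategory.id_apply] at e'
  exact e'

/-- Soundness: `μ` is fibrewise monotone and preserves finite meets, so it carries the inequality
that expresses derivability to the one that defines satisfaction. -/
theorem satisfies_of_der {D : Type w} [Category.{u} D] {Q : Dᵒᵖ ⥤ HeytAlg.{u}} {M : Ty S ⥤ D}
    (μ : termDoctrine S ⟶ M.op ⋙ Q) {σ : Ty S} {Φ : List (Fm [σ])} {ψ : Fm [σ]}
    (h : Der [σ] Φ ψ) : Satisfies Q M μ σ Φ ψ := by
  have e : ∀ Φ : List (Fm [σ]), (Φ.map fun φ => μ.app (op σ) (pred φ)).foldr (· ⊓ ·) ⊤ =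
      μ.app (op σ) (pred (Φ.foldr .and .top)) := by
    intro Φ
    induction Φ with
    | nil => exact (map_top (μ.app (op σ)).hom).symm
    | cons φ Φ ih =>
      rw [List.map_cons, List.foldr_cons, ih, List.foldr_cons]
      exact (map_inf (μ.app (op σ)).hom _ _).symm
  rw [Satisfies, e]
  exact OrderHomClass.mono (μ.app (op σ)).hom (pred_le_iff.2 (Der.conj.2 h))

/-- With identity components, the inequality that defines satisfaction is the order of the fibre
itself. -/
theorem satisfies_generic_iff {σ : Ty S} {Φ : List (Fm [σ])} {ψ : Fm [σ]} :
    Satisfies (termDoctrine S) (𝟭 (Ty S)) (genericTrans S) σ Φ ψ ↔ Der [σ] Φ ψ := by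
  refine ⟨fun h => Der.conj.1 (pred_le_iff.1 ?_), satisfies_of_der _⟩
  have e : ∀ Φ : List (Fm [σ]), (Φ.map fun φ => (genericTrans S).app (op σ) (pred φ)).foldr
      (· ⊓ ·) ⊤ = pred (Φ.foldr .and .top) := by
    intro Φ
    induction Φ with
    | nil => rfl
    | cons φ Φ ih =>
      rw [List.map_cons, List.foldr_cons, ih]
      rfl
  rw [Satisfies, e] at h
  exact h

theorem prodComparison_id {C : Type*} [Category.{u} C] [CartesianMonoidalCategory C] (X Y : C) :
    CartesianMonoidalCategory.prodComparison (𝟭 C) X Y = 𝟙 (X ⊗ Y) :=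
  CartesianMonoidalCategory.hom_ext _ _ (by simp) (by simp)

theorem isMorphism_generic (S : Signature.{u}) :
    IsMorphism (termDoctrine S) (termClosure S) (termDoctrine S) (termClosure S) (𝟭 (Ty S))
      (genericTrans S) where
  map_ex σ τ ex ex' h h' a b hab := by
    rw [prodComparison_id] at hab
    -- The comparison map of the identity functor is the identity, so `a` and `b` agree; what
    -- remains is uniqueness of adjoints.
    have hab : b = a := (congrArg (fun f => f b) ((termDoctrine S).map_id _)).symm.trans hab
    subst hab
    exact h.l_unique h' fun _ => rfl
  map_all σ τ all all' h h' a b hab := by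
    rw [prodComparison_id] at hab
    have hab : b = a := (congrArg (fun f => f b) ((termDoctrine S).map_id _)).symm.trans hab
    subst hab
    exact h.u_unique h' fun _ => rfl
  map_eq σ δ δ' h h' := by
    rw [prodComparison_id]
    exact (h.unique h').trans (congrArg (fun f => f δ') ((termDoctrine S).map_id _)).symm
  continuous σ a := le_refl (termClosure S σ a)

theorem isModel_generic (S : Signature.{u}) [MonoidalClosed (Ty S)] :
    IsModel (termDoctrine S) (termClosure S) (𝟭 (Ty S)) (genericTrans S) where
  toIsMorphism := isMorphism_generic S
  target := isElementaryClosureHyperdoctrine_term S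
  -- A predicate over `σ` is by definition a morphism from `σ` to `Prop`.
  representable := ⟨Ty.prop S, ⟨{ homEquiv := Equiv.refl _, homEquiv_comp := fun _ _ => rfl }⟩,
    ⟨Iso.refl _⟩⟩
  preservesExponentials :=
    -- The identity is fully faithful and its own left adjoint, and it preserves products; hence it
    -- preserves exponentials for any closed structure.
    cartesianClosedFunctorOfLeftAdjointPreservesBinaryProducts (𝟭 (Ty S)) Adjunction.id
  isOpen _ _ := rfl

end SLCS

/-! ### Soundness and completeness -/

open SLCS in
theorem mainTheorem3 (S : Signature.{u}) :
    -- the classifying category (which has finite products) is cartesian closed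
    Nonempty (MonoidalClosed (Ty S)) ∧
    -- terms of type `Prop`, with `[φ] ↦ [C(φ)]`, form an (elementary) closure hyperdoctrine
    (∀ (σ : Ty S) (φ : Fm [σ]), termClosure S σ (pred φ) = pred (.cl φ)) ∧
    IsElementaryClosureHyperdoctrine (termDoctrine S) (termClosure S) ∧
    (∀ σ : Ty S, IsFiberedEquality (termDoctrine S) σ
      (pred (σ := .prod σ σ) (.eq (.fst (.var .z)) (.snd (.var .z))))) ∧
    -- its order is derivability
    (∀ (σ : Ty S) (φ ψ : Fm [σ]), pred φ ≤ pred ψ ↔ Der [σ] [φ] ψ) ∧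
    ∀ [MonoidalClosed (Ty S)],
      -- the generic model is a model, and it satisfies exactly the derivable sequents
      IsModel (termDoctrine S) (termClosure S) (𝟭 (Ty S)) (genericTrans S) ∧
      (∀ (σ : Ty S) (Φ : List (Fm [σ])) (ψ : Fm [σ]),
        Satisfies (termDoctrine S) (𝟭 (Ty S)) (genericTrans S) σ Φ ψ ↔ Der [σ] Φ ψ) ∧
      (∀ (Γ : List (Ty S)) (Φ : List (Fm Γ)) (ψ : Fm Γ),
        SatisfiesCtx (termDoctrine S) (𝟭 (Ty S)) (genericTrans S) Γ Φ ψ ↔ Der Γ Φ ψ) ∧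
      -- soundness
      (∀ (D : Type w) [Category.{u} D] [CartesianMonoidalCategory D] [MonoidalClosed D]
        (Q : Dᵒᵖ ⥤ HeytAlg.{u}) (d : ∀ X : D, Q.obj (op X) → Q.obj (op X))
        (M : Ty S ⥤ D) (μ : termDoctrine S ⟶ M.op ⋙ Q), IsModel Q d M μ →
        (∀ (σ : Ty S) (Φ : List (Fm [σ])) (ψ : Fm [σ]), Der [σ] Φ ψ → Satisfies Q M μ σ Φ ψ) ∧
        (∀ (Γ : List (Ty S)) (Φ : List (Fm Γ)) (ψ : Fm Γ),
          Der Γ Φ ψ → SatisfiesCtx Q M μ Γ Φ ψ)) ∧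
      -- completeness
      (∀ (σ : Ty S) (Φ : List (Fm [σ])) (ψ : Fm [σ]),
        (∀ (D : Type u) [Category.{u} D] [CartesianMonoidalCategory D] [MonoidalClosed D]
          (Q : Dᵒᵖ ⥤ HeytAlg.{u}) (d : ∀ X : D, Q.obj (op X) → Q.obj (op X))
          (M : Ty S ⥤ D) (μ : termDoctrine S ⟶ M.op ⋙ Q), IsModel Q d M μ →
          Satisfies Q M μ σ Φ ψ) → Der [σ] Φ ψ) ∧
      (∀ (Γ : List (Ty S)) (Φ : List (Fm Γ)) (ψ : Fm Γ),
        (∀ (D : Type u) [Category.{u} D] [CartesianMonoidalCategory D] [MonoidalClosed D]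
          (Q : Dᵒᵖ ⥤ HeytAlg.{u}) (d : ∀ X : D, Q.obj (op X) → Q.obj (op X))
          (M : Ty S ⥤ D) (μ : termDoctrine S ⟶ M.op ⋙ Q), IsModel Q d M μ →
          SatisfiesCtx Q M μ Γ Φ ψ) → Der Γ Φ ψ) := by
  refine ⟨⟨monoidalClosedTy⟩, fun _ _ => rfl, isElementaryClosureHyperdoctrine_term S,
    isFiberedEquality_term, fun _ _ _ => pred_le_iff, ?_⟩
  intro _
  exact ⟨isModel_generic S, fun _ _ _ => satisfies_generic_iff,
    fun _ _ _ => satisfies_generic_iff.trans Der.ctx_iff,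
    fun _ _ _ _ _ _ _ μ _ => ⟨fun _ _ _ h => satisfies_of_der μ h,
      fun _ _ _ h => satisfies_of_der μ (Der.ctx_iff.2 h)⟩,
    -- Completeness: the assumption is applied to the generic model, whose category has its objects
    -- in `Type u`, so that models of this size suffice.
    fun _ _ _ h => satisfies_generic_iff.1 (h _ _ _ _ _ (isModel_generic S)),
    fun _ _ _ h => Der.ctx_iff.1 (satisfies_generic_iff.1 (h _ _ _ _ _ (isModel_generic S)))⟩
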